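/- Let $n\ge 1$, and equip $\mathbb R^n$ with the metric $d_\infty(x,y)=\max_i|x_i-y_i|$; $B[x,r]$ denotes the closed ball of centre $x$ and radius $r$ in this metric. Let $A$ be a diagonal $n\times n$ matrix with diagonal entries $\beta_{11},\dots,\beta_{nn}\in(0,1)$, and for $t>0$ let $A^t$ be the diagonal matrix with entries $\beta_{jj}^t$. For $\rho_1\ge\rho_2>0$, $\alpha>0$ and $c\in(0,1)$, the $(\alpha,A,c,\rho_2,\rho_1)$-potential game is played as follows. On turn $1$ Player I chooses $r\in[\rho_2,\rho_1]$ and $b_1\in\mathbb R^n$ and plays $U_1=A(B[0,r])+b_1$; on turn $m\ge2$ Player I plays a set $U_m=A^m(B[0,r])+b_m$, $b_m\in\mathbb R^n$, with $U_m\subseteq U_{m-1}$. On each turn $m\ge1$, knowing $U_1,\dots,U_m$, Player II answers with an at most countable (possibly empty) collection $\mathcal A(U_m,\dots,U_1)$ of pairs $(q,z)$ with $q\in\mathbb R$, $q\ge1$ and $z\in\mathbb R^n$, such that $$\sum_{(q,z)\in\mathcal A(U_m,\dots,U_1)}\ \prod_{j=1}^n\bigl(\beta_{jj}^{q}\bigr)^c\le\Bigl(\alpha\prod_{j=1}^n\beta_{jj}^m\Bigr)^c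 .$$ The outcome $x_\infty$ is the unique point of $\bigcap_{m\ge1}U_m$. A set $S\subseteq\mathbb R^n$ is called $(\alpha,A,c,\rho_2,\rho_1)$-winning if Player II has a strategy which ensures that if $$x_\infty\notin\bigcup_{m\ge1}\ \bigcup_{(q,z)\in\mathcal A(U_m,\dots,U_1)}\bigl(A^q(B[0,r])+z\bigr),$$ then $x_\infty\in S$. **Theorem.** Let $A$ be a diagonal $n\times n$ matrix with diagonal entries $\beta_{11},\dots,\beta_{nn}\in(0,1/5)$, let $\alpha,c\in(0,1)$ and $\rho_2>0$, and let $\delta\in(0,1)$ satisfy $$\alpha^c\le\delta^2\Bigl(1-\Bigl(\prod_{j=1}^n\beta_{jj}\Bigr)^{1-c}\Bigr)\quad\text{and}\quad 3^{-n}\prod_{j=1}^n\Bigl(1-5\beta_{jj}^{\lfloor\delta\alpha^{-1}\rfloor}\Bigr)>8^n(1+2^{2n+1})\,\delta .$$ Then for every set $S\subseteq\mathbb R^n$ that is $(\alpha,A,c,\rho_2,\rho_1)$-winning for some $\rho_1\ge\rho_2$, and for every $y\in\mathbb R^n$, the set $S\cap\bigl(A(B[0,\rho_2])+y\bigr)$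 is non-empty, and its Hausdorff dimension satisfies $$\dim_H\Bigl(S\cap\bigl(A(B[0,\rho_2])+y\bigr)\Bigr)\ge\max\Bigl\{n-K_1\frac{\alpha}{|\log\beta_{\max}|},\,0\Bigr\},$$ where $\beta_{\max}=\max_{1\le j\le n}\beta_{jj}$ and $$K_1=2\delta^{-1}\Bigl|\log\Bigl(3^{-n}\prod_{j=1}^n\Bigl(1-5\beta_{jj}^{\lfloor\delta\alpha^{-1}\rfloor}\Bigr)-8^n(1+2^{2n+1})\,\delta\Bigr)\Bigr| .$$ -/

import Mathlib

open scoped Matrix ENNReal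

/-! The space `ℝⁿ` is `Fin n → ℝ`, whose metric is the square (maximum) metric. -/

noncomputable section

namespace MatrixPotentialGame

variable {n : ℕ}

/-- The set `M(B[0,r]) + z`. -/
def affineBox (M : Matrix (Fin n) (Fin n) ℝ) (r : ℝ) (z : Fin n → ℝ) : Set (Fin n → ℝ) :=
  (fun x => M *ᵥ x + z) '' Metric.closedBall 0 r

/-- The real power `A^t` of a diagonal matrix `A`, taken on the diagonal entries. -/
def diagPow (A : Matrix (Fin n) (Fin n) ℝ) (t : ℝ) : Matrix (Fin n) (Fin n) ℝ :=
  Matrix.diagonal fun j => A j j ^ t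

/-- `U` is a legal infinite sequence of plays of Player I with first radius `r ∈ [ρ₂, ρ₁]`.
Turns are counted from `0`: `U m` is the play on turn `m + 1`, a translate of `A^(m+1)(B[0,r])`
that lies in the preceding play. -/
def IsPlay (A : Matrix (Fin n) (Fin n) ℝ) (ρ₂ ρ₁ r : ℝ) (U : ℕ → Set (Fin n → ℝ)) : Prop :=
  ρ₂ ≤ r ∧ r ≤ ρ₁ ∧ (∀ m, ∃ b, U m = affineBox (A ^ (m + 1)) r b) ∧ ∀ m, U (m + 1) ⊆ U m

/-- The collection `C` of pairs `(q, y)` is allowed for Player II on turn `m ≥ 1`. The empty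
collection is a skip. For `c = 0` at most one pair may be chosen. -/
def IsLegalResponse (A : Matrix (Fin n) (Fin n) ℝ) (α c : ℝ) (m : ℕ)
    (C : Set (ℝ × (Fin n → ℝ))) : Prop :=
  C.Countable ∧ (∀ p ∈ C, 1 ≤ p.1) ∧
  (0 < c → ∑' p : C, ENNReal.ofReal (∏ j, (A j j ^ (p : ℝ × (Fin n → ℝ)).1) ^ c)
      ≤ ENNReal.ofReal ((α * ∏ j, A j j ^ m) ^ c)) ∧
  (c = 0 → C.Subsingleton ∧ ∀ p ∈ C, ∏ j, A j j ^ p.1 ≤ α * ∏ j, A j j ^ m)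

/-- The region deleted by a collection of pairs `(q, y)`: the union of the sets
`A^q(B[0,r]) + y`. -/
def deleted (A : Matrix (Fin n) (Fin n) ℝ) (r : ℝ) (C : Set (ℝ × (Fin n → ℝ))) :
    Set (Fin n → ℝ) :=
  ⋃ p ∈ C, affineBox (diagPow A p.1) r p.2

/-- A strategy of Player II: on each turn it answers the list of all plays that Player I has made
so far (`σ m` gets the `m + 1` plays of the turns `1, …, m + 1`). -/
abbrev Strategy (n : ℕ) : Type :=
  (m : ℕ) → (Fin (m + 1) → Set (Fin n → ℝ)) → Set (ℝ × (Fin n → ℝ))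

/-- The answer of the strategy `σ` on turn `m + 1` to the plays `U`. -/
def Strategy.response (σ : Strategy n) (U : ℕ → Set (Fin n → ℝ)) (m : ℕ) :
    Set (ℝ × (Fin n → ℝ)) :=
  σ m fun i => U i

/-- `S` is `(α, A, c, ρ₂, ρ₁)`-winning: Player II has a strategy that answers every legal sequence
of plays by legal collections, and which ensures that the outcome (the common point of all
the plays of Player I), unless it is deleted, belongs to `S`. -/
def IsWinning (α : ℝ) (A : Matrix (Fin n) (Fin n) ℝ) (c ρ₂ ρ₁ : ℝ) (S : Set (Fin n → ℝ)) : Prop :=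
  ∃ σ : Strategy n, ∀ (r : ℝ) (U : ℕ → Set (Fin n → ℝ)), IsPlay A ρ₂ ρ₁ r U →
    (∀ m, IsLegalResponse A α c (m + 1) (σ.response U m)) ∧
    ∀ x ∈ ⋂ m, U m, x ∉ ⋃ m, deleted A r (σ.response U m) → x ∈ S

/-- The family of sets that are `(α, A, c, ρ₂, ρ₁)`-winning for some `ρ₁ ≥ ρ₂`. -/
def winningFamily (α : ℝ) (A : Matrix (Fin n) (Fin n) ℝ) (c ρ₂ : ℝ) : Set (Set (Fin n → ℝ)) :=
  {S | ∃ ρ₁, ρ₂ ≤ ρ₁ ∧ IsWinning α A c ρ₂ ρ₁ S}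

/-- The number `3⁻ⁿ ∏ⱼ (1 - 5 βⱼⱼ ^ ⌊δ/α⌋)`. -/
def mainTerm (A : Matrix (Fin n) (Fin n) ℝ) (α δ : ℝ) : ℝ :=
  (3 ^ n)⁻¹ * ∏ j, (1 - 5 * A j j ^ ⌊δ * α⁻¹⌋₊)

/-- The number `8ⁿ (1 + 2^(2n+1)) δ`. -/
def errorTerm (n : ℕ) (δ : ℝ) : ℝ :=
  8 ^ n * (1 + 2 ^ (2 * n + 1)) * δ

/-- The constant `K₁ = 2 δ⁻¹ |log (3⁻ⁿ ∏ⱼ (1 - 5 βⱼⱼ ^ ⌊δ/α⌋) - 8ⁿ (1 + 2^(2n+1)) δ)|`. -/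
def K₁ (A : Matrix (Fin n) (Fin n) ℝ) (α δ : ℝ) : ℝ :=
  2 * δ⁻¹ * |Real.log (mainTerm A α δ - errorTerm n δ)|

/-- The largest diagonal entry of `A` (for `n ≥ 1`). -/
def betaMax (A : Matrix (Fin n) (Fin n) ℝ) : ℝ :=
  ⨆ j, A j j

end MatrixPotentialGame

end

noncomputable section

namespace MatrixPotentialGame

/-! ### Boxes, and counting the grid boxes that a deleted set can hit -/

section

variable {n : ℕ}

/-! Fix a winning strategy of Player II and put `N = ⌊δ/α⌋`, `P = ∏ βⱼⱼ`. Player I is given a tree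
of plays, all with radius `ρ₂`, starting from the box `A(B[0,ρ₂]) + y`. The boxes of generation `j`
are played on turn `jN + 1`. Inside each of them lie at least `3⁻ⁿ ∏ (1 - 5βⱼⱼ^N) P⁻ᴺ` boxes of the
next generation, taken from a grid (`le_card_digits`). The turns in between follow a rounding chain:
the intermediate boxes lie on grids too, so on the `k`-th turn after a generation Player II sees
only about `P⁻ᵏ` different histories (`card_image_chain_le`). Without this the answers along
different branches would be too numerous to control.

A deleted set with exponent `q` has weight `P^(qc)`, and the potential of a box is the total weight
of the sets deleted earlier that meet it. A box of generation `j` is good if its potential is at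
most `δ (P^(jN+1))^c`. The children of a good box are mostly good: a bad child carries truncated
relative weight at least `1` (`one_le_sum_min_of_lt_sum`), while a deleted set meets a bounded
number of grid boxes relative to its volume (`card_hits_le`). Summing the weights of the old sets
and of those deleted on the `N` new turns (`total_weight_le`) leaves at most `errorTerm n δ * P⁻ᴺ`
bad children (`card_bad_digits_le`). Hence every good box has at least `κ P⁻ᴺ` good children, where
`κ > 0` is the main term minus the error term.

The limit point of a good branch is never deleted: a set containing it would keep its fixed weight
in the potentials of all later boxes, whose bounds tend to zero (`not_mem_of_potential_le`). So all
these points lie in `S`. Words over an alphabet of `M = ⌈κ P⁻ᴺ⌉` letters code the good branches, and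
the mass distribution principle for the uniform product measure (`le_dimH_of_coding`) gives
dimension at least `n - ε` as soon as `(β_max^N)^ε ≤ κ`. The bound `N ≥ δ/(2α)` turns this into `ε =
K₁ α / |log β_max|`. -/

/-- The closed box with centre `z` and half side lengths `s`. -/
def box (z s : Fin n → ℝ) : Set (Fin n → ℝ) := {x | ∀ i, |x i - z i| ≤ s i}

lemma affineBox_diagonal {d : Fin n → ℝ} (hd : ∀ i, 0 < d i) {r : ℝ} (hr : 0 ≤ r)
    (z : Fin n → ℝ) : affineBox (Matrix.diagonal d) r z = box z fun i => r * d i := by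
  ext x
  simp only [affineBox, box, Set.mem_image, mem_closedBall_zero_iff, pi_norm_le_iff_of_nonneg hr,
    Set.mem_ofPred_eq, Real.norm_eq_abs]
  constructor
  · rintro ⟨v, hv, rfl⟩ i
    simp only [Pi.add_apply, Matrix.mulVec_diagonal, add_sub_cancel_right, abs_mul,
      abs_of_pos (hd i)]
    nlinarith [hv i, hd i]
  · intro h
    refine ⟨fun i => (x i - z i) / d i, fun i => ?_, ?_⟩
    · rw [abs_div, abs_of_pos (hd i), div_le_iff₀ (hd i)]
      exact h i
    · ext i
      simp only [Pi.add_apply, Matrix.mulVec_diagonal]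
      field_simp [(hd i).ne']
      ring

lemma isCompact_box (z s : Fin n → ℝ) : IsCompact (box z s) := by
  have : box z s = Set.Icc (z - s) (z + s) := by
    ext x
    simp only [box, Set.mem_ofPred_eq, abs_le, Set.mem_Icc, Pi.le_def, Pi.sub_apply, Pi.add_apply,
      ← forall_and]
    refine forall_congr' fun i => ?_
    constructor <;> rintro ⟨h₁, h₂⟩ <;> constructor <;> linarith
  rw [this]
  exact isCompact_Icc

lemma box_subset_box {z z' s s' : Fin n → ℝ} (h : ∀ i, |z i - z' i| ≤ s' i - s i) :
    box z s ⊆ box z' s' := by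
  intro x hx i
  have := abs_sub_le (x i) (z i) (z' i)
  linarith [hx i, h i]

lemma card_int_le (s : Finset ℤ) (a : ℝ) {h : ℝ} (hh : 0 ≤ h) (hs : ∀ z ∈ s, |(z : ℝ) - a| ≤ h) :
    (s.card : ℝ) ≤ 2 * h + 1 := by
  have hsub : s ⊆ Finset.Icc ⌈a - h⌉ ⌊a + h⌋ := by
    intro z hz
    have := abs_le.1 (hs z hz)
    rw [Finset.mem_Icc, Int.ceil_le, Int.le_floor]
    constructor <;> linarith
  have h₁ : (s.card : ℤ) ≤ max (⌊a + h⌋ + 1 - ⌈a - h⌉) 0 := by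
    have := Finset.card_le_card hsub
    rw [Int.card_Icc] at this
    omega
  have h₂ : (s.card : ℝ) ≤ max ((⌊a + h⌋ : ℝ) + 1 - ⌈a - h⌉) 0 := by exact_mod_cast h₁
  refine h₂.trans (max_le ?_ (by linarith))
  linarith [Int.floor_le (a + h), Int.le_ceil (a - h)]

lemma card_int_vec_le (s : Finset (Fin n → ℤ)) (a h : Fin n → ℝ) (hh : ∀ i, 0 ≤ h i)
    (hs : ∀ z ∈ s, ∀ i, |(z i : ℝ) - a i| ≤ h i) : (s.card : ℝ) ≤ ∏ i, (2 * h i + 1) := by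
  classical
  have hsub : s ⊆ Fintype.piFinset fun i => s.image fun z => z i := by
    intro z hz
    rw [Fintype.mem_piFinset]
    exact fun i => Finset.mem_image_of_mem _ hz
  have h₁ := Finset.card_le_card hsub
  rw [Fintype.card_piFinset] at h₁
  refine (Nat.cast_le.2 h₁).trans ?_
  rw [Nat.cast_prod]
  refine Finset.prod_le_prod (fun i _ => Nat.cast_nonneg _) fun i _ => ?_
  refine card_int_le _ (a i) (hh i) fun z hz => ?_
  obtain ⟨v, hv, rfl⟩ := Finset.mem_image.1 hz
  exact hs v hv i

/-- The set deleted by the pair `p` meets the box with centre `z` and half side lengths `s`. -/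
def Hits (β : Fin n → ℝ) (r : ℝ) (p : ℝ × (Fin n → ℝ)) (z s : Fin n → ℝ) : Prop :=
  (box p.2 (fun i => r * β i ^ p.1) ∩ box z s).Nonempty

lemma Hits.abs_sub_le {β : Fin n → ℝ} {r : ℝ} {p : ℝ × (Fin n → ℝ)} {z s : Fin n → ℝ}
    (h : Hits β r p z s) (i : Fin n) : |z i - p.2 i| ≤ r * β i ^ p.1 + s i := by
  obtain ⟨x, hx, hx'⟩ := h
  have h₁ := _root_.abs_sub_le (z i) (x i) (p.2 i)
  have h₂ := hx' i
  rw [abs_sub_comm] at h₂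
  linarith [hx i]

lemma Hits.mono {β : Fin n → ℝ} {r : ℝ} {p : ℝ × (Fin n → ℝ)} {z s z' s' : Fin n → ℝ}
    (h : Hits β r p z s) (hs : box z s ⊆ box z' s') : Hits β r p z' s' :=
  Set.Nonempty.mono (Set.inter_subset_inter_right _ hs) h

-- In units of the grid step the admissible indices in coordinate `i` fill an interval of length `uᵢ
-- + 1`, where `uᵢ` is the ratio of the two side lengths. So there are at most `uᵢ + 2 ≤ 3 max(1,
-- uᵢ)` of them.
open Classical in
lemma card_hits_le {β : Fin n → ℝ} (hβ : ∀ i, β i ∈ Set.Ioo (0 : ℝ) 1) {r : ℝ} (hr : 0 < r)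
    (W : Finset (Fin n → ℤ)) (x : Fin n → ℝ) (L : ℕ) (p : ℝ × (Fin n → ℝ)) :
    ((W.filter fun z => Hits β r p (fun i => x i + 2 * r * β i ^ L * z i)
      (fun i => r * β i ^ L)).card : ℝ) ≤ 3 ^ n * max 1 ((∏ i, β i) ^ p.1 / (∏ i, β i) ^ L) := by
  set u : Fin n → ℝ := fun i => β i ^ p.1 / β i ^ L with hu
  have hL : ∀ i, 0 < β i ^ L := fun i => pow_pos (hβ i).1 _
  have hu0 : ∀ i, 0 < u i := fun i => div_pos (Real.rpow_pos_of_pos (hβ i).1 _) (hL i)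
  have h₁ := card_int_vec_le (W.filter fun z => Hits β r p (fun i => x i + 2 * r * β i ^ L * z i)
      (fun i => r * β i ^ L)) (fun i => (p.2 i - x i) / (2 * r * β i ^ L))
      (fun i => (u i + 1) / 2) (fun i => by linarith [hu0 i]) (by
        intro z hz i
        have h := (Finset.mem_filter.1 hz).2.abs_sub_le i
        have hpos : 0 < 2 * r * β i ^ L := by have := hL i; positivity
        have e₁ : (z i : ℝ) - (p.2 i - x i) / (2 * r * β i ^ L)
            = (x i + 2 * r * β i ^ L * z i - p.2 i) / (2 * r * β i ^ L) := by
          have := hpos.ne'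
          rw [eq_div_iff this, sub_mul, div_mul_cancel₀ _ this]
          ring
        rw [e₁, abs_div, abs_of_pos hpos, div_le_iff₀ hpos]
        refine h.trans (le_of_eq ?_)
        have := (hL i).ne'
        simp only [hu]
        field_simp)
  refine h₁.trans ?_
  have hprod : (∏ i, β i) ^ p.1 / (∏ i, β i) ^ L = ∏ i, u i := by
    rw [Finset.prod_div_distrib, ← Real.finsetProd_rpow _ _ (fun i _ => (hβ i).1.le),
      Finset.prod_pow]
  have h3 : (3 : ℝ) ^ n = ∏ _i : Fin n, (3 : ℝ) := by simp
  rw [hprod, h3]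
  -- All ratios `uᵢ` lie on the same side of `1`, decided by the exponents alone. Hence the product
  -- of the maxima is the maximum of the products.
  rcases le_total p.1 L with hq | hq
  · have hu1 : ∀ i, 1 ≤ u i := fun i => by
      rw [hu, one_le_div (hL i), ← Real.rpow_natCast]
      exact Real.rpow_le_rpow_of_exponent_ge (hβ i).1 (hβ i).2.le hq
    refine le_trans ?_ (mul_le_mul_of_nonneg_left (le_max_right _ _)
      (Finset.prod_nonneg fun _ _ => by norm_num))
    rw [← Finset.prod_mul_distrib]
    refine Finset.prod_le_prod (fun i _ => by linarith [hu0 i]) fun i _ => ?_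
    linarith [hu1 i]
  · have hu1 : ∀ i, u i ≤ 1 := fun i => by
      rw [hu, div_le_one (hL i), ← Real.rpow_natCast]
      exact Real.rpow_le_rpow_of_exponent_ge (hβ i).1 (hβ i).2.le hq
    refine le_trans ?_ (mul_le_mul_of_nonneg_left (le_max_left _ _)
      (Finset.prod_nonneg fun _ _ => by norm_num))
    rw [mul_one]
    refine Finset.prod_le_prod (fun i _ => by linarith [hu0 i]) fun i _ => ?_
    linarith [hu1 i]

/-- Here `a = P^q` is the relative volume of a deleted set and `B` that of a grid box. In either
case the product is at most `a / B + a^c / θ`, and `a = (a^c)^(1/c - 1) a^c` makes the first term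
linear in the weight `a^c`. -/
lemma max_mul_min_le {a c T θ B : ℝ} (ha : 0 < a) (hc : c ∈ Set.Ioo (0 : ℝ) 1) (hθ : 0 < θ)
    (hB : 0 < B) (haT : a ^ c ≤ T) :
    max 1 (a / B) * min 1 (a ^ c / θ) ≤ (T ^ (1 / c - 1) / B + 1 / θ) * a ^ c := by
  have hac : 0 < a ^ c := Real.rpow_pos_of_pos ha c
  have hc0 := hc.1
  have h₁ : a ≤ T ^ (1 / c - 1) * a ^ c := by
    have e : a = (a ^ c) ^ (1 / c - 1) * a ^ c := by
      rw [← Real.rpow_mul ha.le, ← Real.rpow_add ha]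
      have : c * (1 / c - 1) + c = 1 := by field_simp; ring
      rw [this, Real.rpow_one]
    conv_lhs => rw [e]
    have h1c : 0 ≤ 1 / c - 1 := by
      rw [sub_nonneg, one_le_div hc0]; exact hc.2.le
    gcongr
  have h₂ : a / B ≤ T ^ (1 / c - 1) / B * a ^ c := by
    rw [div_mul_eq_mul_div]; gcongr
  have h₃ : 0 < a / B := div_pos ha hB
  have h₄ : 0 < a ^ c / θ := div_pos hac hθ
  have h₅ : max 1 (a / B) * min 1 (a ^ c / θ) ≤ a / B + a ^ c / θ := by
    rcases le_total 1 (a / B) with h | h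
    · rw [max_eq_right h]
      nlinarith [min_le_left 1 (a ^ c / θ)]
    · rw [max_eq_left h]
      linarith [min_le_right 1 (a ^ c / θ)]
  refine h₅.trans ?_
  rw [add_mul, one_div_mul_eq_div]
  linarith

/-- The total weight of the boxes of a grid that are hit by the sets of a collection. -/
lemma sum_hits_le {β : Fin n → ℝ} (hβ : ∀ i, β i ∈ Set.Ioo (0 : ℝ) 1) {r : ℝ} (hr : 0 < r)
    {c T θ : ℝ} (hc : c ∈ Set.Ioo (0 : ℝ) 1) (hθ : 0 < θ)
    (W : Finset (Fin n → ℤ)) (x : Fin n → ℝ) (L : ℕ) (R : Set (ℝ × (Fin n → ℝ)))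
    (hR : ∀ p ∈ R, ((∏ i, β i) ^ p.1) ^ c ≤ T) :
    ∑ z ∈ W, ∑' p, {p ∈ R | Hits β r p (fun i => x i + 2 * r * β i ^ L * z i)
        (fun i => r * β i ^ L)}.indicator
          (fun p => ENNReal.ofReal (min 1 (((∏ i, β i) ^ p.1) ^ c / θ))) p
      ≤ ENNReal.ofReal (3 ^ n * (T ^ (1 / c - 1) / (∏ i, β i) ^ L + 1 / θ)) *
        ∑' p, R.indicator (fun p => ENNReal.ofReal (((∏ i, β i) ^ p.1) ^ c)) p := by
  classical
  have hP : 0 < ∏ i, β i := Finset.prod_pos fun i _ => (hβ i).1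
  rw [← Summable.tsum_finsetSum (fun _ _ => ENNReal.summable), ← ENNReal.tsum_mul_left]
  refine ENNReal.tsum_le_tsum fun p => ?_
  by_cases hp : p ∈ R
  · have hac : 0 < ((∏ i, β i) ^ p.1) ^ c :=
      Real.rpow_pos_of_pos (Real.rpow_pos_of_pos hP _) _
    have hT : 0 < T := hac.trans_le (hR p hp)
    simp only [Set.indicator_apply, Set.mem_ofPred_eq, hp, true_and, if_true]
    rw [← Finset.sum_filter, Finset.sum_const, nsmul_eq_mul, ← ENNReal.ofReal_natCast,
      ← ENNReal.ofReal_mul (Nat.cast_nonneg _), ← ENNReal.ofReal_mul (by positivity)]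
    refine ENNReal.ofReal_le_ofReal ?_
    refine (mul_le_mul_of_nonneg_right (card_hits_le hβ hr W x L p)
      (le_min zero_le_one (by positivity))).trans ?_
    rw [mul_assoc, mul_assoc]
    refine mul_le_mul_of_nonneg_left ?_ (by positivity)
    exact max_mul_min_le (Real.rpow_pos_of_pos hP _) hc hθ (by positivity) (hR p hp)
  · simp [hp]

end

/-! ### Rounding chains and the tree of plays of Player I -/

section

variable {n : ℕ}

/-- Iterated rounding: `chain b z t` is an integer close to `2 * b ^ t * z`, and it determines
`chain b z (t + 1)`. -/
def chain (b : ℝ) (z : ℤ) : ℕ → ℤ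
  | 0 => 2 * z
  | t + 1 => round (b * chain b z t)

/-- The constant is the fixed point of the error recursion: `1/2 + (1/5)(5/8) = 5/8`. -/
lemma abs_chain_sub_le {b : ℝ} (hb : b ∈ Set.Ioo (0 : ℝ) (1 / 5)) (z : ℤ) (t : ℕ) :
    |(chain b z t : ℝ) - 2 * b ^ t * z| ≤ 5 / 8 := by
  induction t with
  | zero => norm_num [chain]
  | succ t ih =>
    have h₁ := abs_sub_round (b * chain b z t)
    rw [chain]
    have h₂ : |b * chain b z t - 2 * b ^ (t + 1) * z| ≤ 1 / 8 := by
      rw [show b * chain b z t - 2 * b ^ (t + 1) * z = b * (chain b z t - 2 * b ^ t * z) by ring,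
        abs_mul, abs_of_pos hb.1]
      nlinarith [hb.1, hb.2]
    rw [abs_le] at *
    constructor <;> linarith

lemma chain_eq_of_le {b : ℝ} {z z' : ℤ} {s t : ℕ} (hst : s ≤ t) (h : chain b z s = chain b z' s) :
    chain b z t = chain b z' t := by
  induction t, hst using Nat.le_induction with
  | base => exact h
  | succ t _ ih => rw [chain, chain, ih]

/-- The integer vectors that index the boxes of the next generation inside a given box. -/
def digits (β : Fin n → ℝ) (N : ℕ) : Finset (Fin n → ℤ) :=
  Fintype.piFinset fun i => Finset.Icc (-⌊7 / 40 * (β i ^ N)⁻¹⌋) ⌊7 / 40 * (β i ^ N)⁻¹⌋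

lemma mem_digits_abs_le {β : Fin n → ℝ} (hβ : ∀ i, 0 < β i) {N : ℕ}
    {z : Fin n → ℤ} (hz : z ∈ digits β N) (i : Fin n) : |2 * β i ^ N * z i| ≤ 7 / 20 := by
  have h := Finset.mem_Icc.1 ((Fintype.mem_piFinset.1 hz) i)
  have hL : 0 < β i ^ N := pow_pos (hβ i) _
  have h₁ : |(z i : ℝ)| ≤ 7 / 40 * (β i ^ N)⁻¹ := by
    rw [abs_le]
    have := Int.floor_le (7 / 40 * (β i ^ N)⁻¹)
    have ha : -(⌊7 / 40 * (β i ^ N)⁻¹⌋ : ℝ) ≤ z i := by exact_mod_cast h.1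
    have hb : (z i : ℝ) ≤ ⌊7 / 40 * (β i ^ N)⁻¹⌋ := by exact_mod_cast h.2
    constructor <;> linarith
  rw [abs_mul, abs_of_pos (by positivity)]
  calc 2 * β i ^ N * |(z i : ℝ)| ≤ 2 * β i ^ N * (7 / 40 * (β i ^ N)⁻¹) := by gcongr
    _ = 7 / 20 := by field_simp; norm_num

lemma zero_mem_digits {β : Fin n → ℝ} (hβ : ∀ i, 0 < β i) (N : ℕ) : 0 ∈ digits β N := by
  rw [digits, Fintype.mem_piFinset]
  intro i
  have hL : 0 < β i ^ N := pow_pos (hβ i) _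
  have : 0 ≤ ⌊7 / 40 * (β i ^ N)⁻¹⌋ := Int.floor_nonneg.2 (by positivity)
  simpa using this

/-- With `x = β i ^ (-N)`, each coordinate offers `2⌊7x/40⌋ + 1 > 7x/20 - 1 ≥ (x - 5)/3` values.
This is the source of the factors `1/3` and `1 - 5β^N`. -/
lemma le_card_digits {β : Fin n → ℝ} (hβ : ∀ i, 0 < β i) {N : ℕ} (h5 : ∀ i, 5 * β i ^ N ≤ 1) :
    (3 ^ n)⁻¹ * (∏ i, (1 - 5 * β i ^ N)) * ((∏ i, β i) ^ N)⁻¹ ≤ ((digits β N).card : ℝ) := by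
  have e : (3 ^ n)⁻¹ * (∏ i, (1 - 5 * β i ^ N)) * ((∏ i, β i) ^ N)⁻¹
      = ∏ i, ((β i ^ N)⁻¹ * (1 - 5 * β i ^ N) / 3) := by
    rw [Finset.prod_div_distrib, Finset.prod_mul_distrib, ← Finset.prod_pow,
      Finset.prod_inv_distrib]
    simp
    ring
  rw [e, digits, Fintype.card_piFinset, Nat.cast_prod]
  have hL : ∀ i, 0 < β i ^ N := fun i => pow_pos (hβ i) _
  refine Finset.prod_le_prod (fun i _ => ?_) fun i _ => ?_
  · have := h5 i
    have := hL i
    have : 0 ≤ 1 - 5 * β i ^ N := by linarith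
    positivity
  · rw [Int.card_Icc]
    have h0 : 0 ≤ ⌊7 / 40 * (β i ^ N)⁻¹⌋ := Int.floor_nonneg.2 (by have := hL i; positivity)
    have h1 : (((⌊7 / 40 * (β i ^ N)⁻¹⌋ + 1 - -⌊7 / 40 * (β i ^ N)⁻¹⌋).toNat : ℤ) : ℝ)
        = 2 * ⌊7 / 40 * (β i ^ N)⁻¹⌋ + 1 := by
      rw [Int.toNat_of_nonneg (by omega)]
      push_cast
      ring
    rw [Int.cast_natCast] at h1
    rw [h1, mul_sub, mul_one, mul_left_comm, inv_mul_cancel₀ (hL i).ne']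
    have h2 := Int.sub_one_lt_floor (7 / 40 * (β i ^ N)⁻¹)
    have h3 : 0 < (β i ^ N)⁻¹ := inv_pos.2 (hL i)
    linarith

/-- Since `5/8 + 7/20 < 1`, the chain ends at `0`. The play at the start of a generation is
therefore centred at the node and does not reveal the next digit. -/
lemma chain_eq_zero {b : ℝ} (hb : b ∈ Set.Ioo (0 : ℝ) (1 / 5)) {N : ℕ} {z : ℤ}
    (hz : |2 * b ^ N * z| ≤ 7 / 20) : chain b z N = 0 := by
  have h := abs_chain_sub_le hb z N
  have h' : |(chain b z N : ℝ)| < 1 := by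
    rw [abs_le] at h hz
    rw [abs_lt]
    constructor <;> linarith
  rw [← Int.abs_lt_one_iff]
  exact_mod_cast h'

/-- The centre of the box of generation `j` with address `w`. -/
def node (β : Fin n → ℝ) (N : ℕ) (r : ℝ) (y : Fin n → ℝ) (w : ℕ → Fin n → ℤ) (j : ℕ) :
    Fin n → ℝ :=
  fun i => y i + ∑ l ∈ Finset.range j, 2 * r * β i ^ ((l + 1) * N + 1) * w l i

/-- The half side lengths of the boxes on turn `m + 1`. -/
def size (β : Fin n → ℝ) (r : ℝ) (m : ℕ) : Fin n → ℝ := fun i => r * β i ^ (m + 1)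

/-- The centre of the play on turn `m + 1` along the address `w`. -/
def center (β : Fin n → ℝ) (N : ℕ) (r : ℝ) (y : Fin n → ℝ) (w : ℕ → Fin n → ℤ) (m : ℕ) :
    Fin n → ℝ :=
  fun i => node β N r y w (m / N) i +
    r * β i ^ (m + 1) * chain (β i) (w (m / N) i) (N - m % N)

/-- The plays of Player I along the address `w`. -/
def play (β : Fin n → ℝ) (N : ℕ) (r : ℝ) (y : Fin n → ℝ) (w : ℕ → Fin n → ℤ) (m : ℕ) :
    Set (Fin n → ℝ) :=
  box (center β N r y w m) (size β r m)

variable {β : Fin n → ℝ} {N : ℕ} {r : ℝ} {y : Fin n → ℝ} {w w' : ℕ → Fin n → ℤ}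

lemma node_congr {j : ℕ} (h : ∀ l < j, w l = w' l) : node β N r y w j = node β N r y w' j := by
  funext i
  simp only [node]
  congr 1
  exact Finset.sum_congr rfl fun l hl => by rw [h l (Finset.mem_range.1 hl)]

lemma node_succ (j : ℕ) (i : Fin n) : node β N r y w (j + 1) i
    = node β N r y w j i + 2 * r * β i ^ ((j + 1) * N + 1) * w j i := by
  simp only [node, Finset.sum_range_succ, add_assoc]

lemma center_eq_of_lt {j k : ℕ} (hk : k < N) (i : Fin n) :
    center β N r y w (j * N + k) i = node β N r y w j i +
      r * β i ^ (j * N + k + 1) * chain (β i) (w j i) (N - k) := by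
  have h₁ : (j * N + k) / N = j := by
    rw [add_comm, Nat.add_mul_div_right _ _ (by omega), Nat.div_eq_of_lt hk, zero_add]
  have h₂ : (j * N + k) % N = k := by
    rw [add_comm, Nat.add_mul_mod_self_right, Nat.mod_eq_of_lt hk]
  rw [center, h₁, h₂]

lemma center_mul (hN : 0 < N) (hβ : ∀ i, β i ∈ Set.Ioo (0 : ℝ) (1 / 5))
    (hw : ∀ l, w l ∈ digits β N) (j : ℕ) : center β N r y w (j * N) = node β N r y w j := by
  funext i
  have h := center_eq_of_lt (β := β) (r := r) (y := y) (w := w) (j := j) hN i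
  rw [add_zero, Nat.sub_zero, chain_eq_zero (hβ i)
    (mem_digits_abs_le (fun i => (hβ i).1) (hw j) i)] at h
  simpa using h

/-- The formula persists at `k = N` because `chain` starts at `2 * z`, which is exactly the offset
of the next node. -/
lemma center_eq_of_le (hN : 0 < N) (hβ : ∀ i, β i ∈ Set.Ioo (0 : ℝ) (1 / 5))
    (hw : ∀ l, w l ∈ digits β N) {j k : ℕ} (hk : k ≤ N) (i : Fin n) :
    center β N r y w (j * N + k) i = node β N r y w j i +
      r * β i ^ (j * N + k + 1) * chain (β i) (w j i) (N - k) := by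
  rcases hk.lt_or_eq with hk | rfl
  · exact center_eq_of_lt hk i
  · have e : j * k + k = (j + 1) * k := by ring
    rw [e, center_mul hN hβ hw, node_succ, Nat.sub_self, chain]
    push_cast
    ring

lemma play_mul (hN : 0 < N) (hβ : ∀ i, β i ∈ Set.Ioo (0 : ℝ) (1 / 5))
    (hw : ∀ l, w l ∈ digits β N) (j : ℕ) :
    play β N r y w (j * N) = box (node β N r y w j) (size β r (j * N)) := by
  rw [play, center_mul hN hβ hw]

lemma exists_eq_mul_add (hN : 0 < N) (m : ℕ) : ∃ j k, k < N ∧ m = j * N + k :=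
  ⟨m / N, m % N, Nat.mod_lt _ hN, by rw [mul_comm, Nat.div_add_mod]⟩

/-- Consecutive centres differ only by a rounding error, at most `1/2` in units of the current half
side, while the room available is `1 - β i > 4/5` of it. -/
lemma abs_center_succ_sub_le (hN : 0 < N) (hr : 0 < r) (hβ : ∀ i, β i ∈ Set.Ioo (0 : ℝ) (1 / 5))
    (hw : ∀ l, w l ∈ digits β N) (m : ℕ) (i : Fin n) :
    |center β N r y w (m + 1) i - center β N r y w m i| ≤ size β r m i - size β r (m + 1) i := by
  obtain ⟨j, k, hk, rfl⟩ := exists_eq_mul_add hN m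
  obtain ⟨t, ht⟩ : ∃ t, N - k = t + 1 := ⟨N - k - 1, by omega⟩
  rw [center_eq_of_lt hk, add_assoc (j * N) k 1, center_eq_of_le hN hβ hw (Nat.succ_le_of_lt hk : k + 1 ≤ N), ht,
    show N - (k + 1) = t by omega, chain]
  have h₁ := abs_sub_round (β i * chain (β i) (w j i) t)
  have hb := hβ i
  have hp : 0 < r * β i ^ (j * N + (k + 1)) := mul_pos hr (pow_pos hb.1 _)
  have e : node β N r y w j i + r * β i ^ (j * N + (k + 1) + 1) * chain (β i) (w j i) t -
      (node β N r y w j i + r * β i ^ (j * N + (k + 1)) *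
        round (β i * chain (β i) (w j i) t))
      = r * β i ^ (j * N + (k + 1)) *
        (β i * chain (β i) (w j i) t - round (β i * chain (β i) (w j i) t)) := by
    ring
  rw [e, abs_mul, abs_of_pos hp]
  have e' : size β r (j * N + k) i - size β r (j * N + (k + 1)) i
      = r * β i ^ (j * N + (k + 1)) * (1 - β i) := by
    simp only [size]
    ring
  rw [e']
  refine mul_le_mul_of_nonneg_left ?_ hp.le
  linarith [hb.2]

lemma abs_center_sub_le (hN : 0 < N) (hr : 0 < r) (hβ : ∀ i, β i ∈ Set.Ioo (0 : ℝ) (1 / 5))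
    (hw : ∀ l, w l ∈ digits β N) {m m' : ℕ} (h : m ≤ m') (i : Fin n) :
    |center β N r y w m' i - center β N r y w m i| ≤ size β r m i - size β r m' i := by
  induction m', h using Nat.le_induction with
  | base => simp
  | succ k _ ih =>
    have h₁ := abs_center_succ_sub_le (y := y) hN hr hβ hw k i
    have h₂ := abs_sub_le (center β N r y w (k + 1) i) (center β N r y w k i)
      (center β N r y w m i)
    linarith

lemma play_anti (hN : 0 < N) (hr : 0 < r) (hβ : ∀ i, β i ∈ Set.Ioo (0 : ℝ) (1 / 5))
    (hw : ∀ l, w l ∈ digits β N) : Antitone (play β N r y w) := fun _ _ h =>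
  box_subset_box fun i => abs_center_sub_le hN hr hβ hw h i

lemma exists_mem_iInter_play (hN : 0 < N) (hr : 0 < r)
    (hβ : ∀ i, β i ∈ Set.Ioo (0 : ℝ) (1 / 5)) (hw : ∀ l, w l ∈ digits β N) :
    ∃ x, ∀ m, x ∈ play β N r y w m := by
  have := IsCompact.nonempty_iInter_of_sequence_nonempty_isCompact_isClosed (play β N r y w)
    (fun m => play_anti hN hr hβ hw m.le_succ)
    (fun m => ⟨center β N r y w m, fun i => by
      have := (hβ i).1
      simp only [sub_self, abs_zero, size]
      positivity⟩)
    (isCompact_box _ _) (fun m => (isCompact_box _ _).isClosed)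
  obtain ⟨x, hx⟩ := this
  exact ⟨x, Set.mem_iInter.1 hx⟩

/-- The plays up to turn `j * N + k + 1` depend only on the first `j` digits and on one term of
the rounding chain of the next digit. -/
lemma play_congr {j k : ℕ} (hk : k < N) (h : ∀ l < j, w l = w' l)
    (hc : ∀ i, chain (β i) (w j i) (N - k) = chain (β i) (w' j i) (N - k)) :
    ∀ m ≤ j * N + k, play β N r y w m = play β N r y w' m := by
  intro m hm
  obtain ⟨j', k', hk', rfl⟩ := exists_eq_mul_add (by omega : 0 < N) m
  have hj : j' ≤ j := by
    by_contra hj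
    have : (j + 1) * N ≤ j' * N := Nat.mul_le_mul_right _ (by omega)
    rw [add_mul] at this
    omega
  have hcen : center β N r y w (j' * N + k') = center β N r y w' (j' * N + k') := by
    funext i
    rw [center_eq_of_lt hk', center_eq_of_lt hk',
      node_congr (w := w) (w' := w') fun l hl => h l (by omega)]
    rcases hj.lt_or_eq with hj | rfl
    · rw [h _ hj]
    · rw [chain_eq_of_le (by omega : N - k ≤ N - k') (hc i)]
  rw [play, play, hcen]

lemma play_congr_of_lt (hN : 0 < N) {j : ℕ} (h : ∀ l < j, w l = w' l) {m : ℕ} (hm : m < j * N) :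
    play β N r y w m = play β N r y w' m := by
  obtain ⟨i, k, hk, rfl⟩ := exists_eq_mul_add hN m
  have hi : i < j := by
    by_contra hi
    have : j * N ≤ i * N := Nat.mul_le_mul_right _ (by omega)
    omega
  exact play_congr hk (fun l hl => h l (by omega)) (fun _ => by rw [h i hi]) _ le_rfl

end

/-! ### Numerical estimates and the truncation of weights -/

section

variable {n : ℕ}

section Numeric

variable {P α c δ : ℝ}

lemma one_le_floor_mul_inv (hα : α ∈ Set.Ioo (0 : ℝ) 1) (hc : c ∈ Set.Ioo (0 : ℝ) 1)
    (hδ : δ ∈ Set.Ioo (0 : ℝ) 1) (h : α ^ c ≤ δ ^ 2) : 1 ≤ ⌊δ * α⁻¹⌋₊ := by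
  have h₁ : α ≤ α ^ c := by
    conv_lhs => rw [← Real.rpow_one α]
    exact Real.rpow_le_rpow_of_exponent_ge hα.1 hα.2.le hc.2.le
  have hα0 := hα.1
  rw [Nat.one_le_floor_iff, ← div_eq_mul_inv, one_le_div hα.1]
  nlinarith [hδ.1, hδ.2]

lemma floor_mul_inv_mul_le (hα : 0 < α) (hδ : 0 < δ) : (⌊δ * α⁻¹⌋₊ : ℝ) * α ≤ δ := by
  have := Nat.floor_le (by positivity : 0 ≤ δ * α⁻¹)
  calc (⌊δ * α⁻¹⌋₊ : ℝ) * α ≤ δ * α⁻¹ * α := by gcongr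
    _ = δ := by field_simp

lemma le_two_mul_floor_mul (hα : 0 < α) (h : 1 ≤ ⌊δ * α⁻¹⌋₊) :
    δ ≤ 2 * (⌊δ * α⁻¹⌋₊ : ℝ) * α := by
  have h₁ := Nat.lt_floor_add_one (δ * α⁻¹)
  have h₂ : (1 : ℝ) ≤ ⌊δ * α⁻¹⌋₊ := by exact_mod_cast h
  calc δ = δ * α⁻¹ * α := by field_simp
    _ ≤ 2 * (⌊δ * α⁻¹⌋₊ : ℝ) * α := mul_le_mul_of_nonneg_right (by linarith) hα.le

/-- With `x = P^(1-c)` the hypotheses give `N (1 - x) ≥ 1/(2δ)`. Hence `x^N ≤ exp(-1/(2δ)) ≤ δ`, the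
last step being `exp u ≥ 2u` for `u = 1/(2δ)`. -/
lemma pow_rpow_one_sub_le {N : ℕ} (hP : P ∈ Set.Ioo (0 : ℝ) 1) (hα : α ∈ Set.Ioo (0 : ℝ) 1)
    (hc : c ∈ Set.Ioo (0 : ℝ) 1) (hδ : δ ∈ Set.Ioo (0 : ℝ) 1)
    (h : α ^ c ≤ δ ^ 2 * (1 - P ^ (1 - c))) (hN : δ ≤ 2 * N * α) : (P ^ N) ^ (1 - c) ≤ δ := by
  have h₁ : α ≤ α ^ c := by
    conv_lhs => rw [← Real.rpow_one α]
    exact Real.rpow_le_rpow_of_exponent_ge hα.1 hα.2.le hc.2.le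
  have hP0 := hP.1
  set x := P ^ (1 - c) with hx
  have hx0 : 0 < x := Real.rpow_pos_of_pos hP.1 _
  have e : (P ^ N) ^ (1 - c) = x ^ N := by
    rw [hx, ← Real.rpow_natCast, ← Real.rpow_natCast, ← Real.rpow_mul hP.1.le,
      ← Real.rpow_mul hP.1.le, mul_comm]
  have h₂ : 1 / (2 * δ) ≤ N * (1 - x) := by
    have hδ0 := hδ.1
    rw [div_le_iff₀ (by positivity)]
    have : δ ≤ 2 * N * (δ ^ 2 * (1 - x)) := hN.trans (by gcongr; linarith)
    have h3 : δ * 1 ≤ δ * (N * (1 - x) * (2 * δ)) := by linarith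
    exact le_of_mul_le_mul_left h3 hδ0
  have h₃ : x ≤ Real.exp (-(1 - x)) := by
    have := Real.add_one_le_exp (-(1 - x))
    linarith
  have h₄ : x ^ N ≤ Real.exp (-(1 / (2 * δ))) := by
    calc x ^ N ≤ Real.exp (-(1 - x)) ^ N := by gcongr
      _ = Real.exp (-(N * (1 - x))) := by rw [← Real.exp_nat_mul]; ring_nf
      _ ≤ _ := Real.exp_le_exp.2 (by linarith)
  have h₅ : 1 / δ ≤ Real.exp (1 / (2 * δ)) := by
    have hδ0 := hδ.1
    have hq := Real.quadratic_le_exp_of_nonneg (x := 1 / (2 * δ)) (by positivity)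
    have e : 1 / δ = 2 * (1 / (2 * δ)) := by field_simp
    rw [e]
    nlinarith [sq_nonneg (1 / (2 * δ) - 1)]
  rw [e]
  refine h₄.trans ?_
  rw [Real.exp_neg]
  have := hδ.1
  rw [inv_le_comm₀ (Real.exp_pos _) this]
  simpa using h₅

/-- The `k`-th term equals `P⁻ᴺ x^(N-k)` with `x = P^(1-c) < 1`, so this is a geometric sum. -/
lemma sum_pow_mul_inv_le {N : ℕ} (hP : P ∈ Set.Ioo (0 : ℝ) 1) (hc : c ∈ Set.Ioo (0 : ℝ) 1) :
    ∑ k ∈ Finset.range N, (P ^ k)⁻¹ * (P ^ k / P ^ N) ^ c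
      ≤ (P ^ N)⁻¹ * (1 - P ^ (1 - c))⁻¹ := by
  have hP0 := hP.1
  set x := P ^ (1 - c) with hx
  have hx0 : 0 < x := Real.rpow_pos_of_pos hP.1 _
  have hx1 : x < 1 := Real.rpow_lt_one hP.1.le hP.2 (by linarith [hc.2])
  have e : ∀ k ∈ Finset.range N, (P ^ k)⁻¹ * (P ^ k / P ^ N) ^ c
      = (P ^ N)⁻¹ * x ^ (N - 1 - k + 1) := by
    intro k hk
    obtain ⟨t, rfl⟩ : ∃ t, N = k + (t + 1) :=
      ⟨N - k - 1, by have := Finset.mem_range.1 hk; omega⟩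
    have h1 : P ^ k / P ^ (k + (t + 1)) = (P ^ (t + 1))⁻¹ := by
      rw [pow_add]
      field_simp
    have h2 : x ^ (t + 1) = P ^ (t + 1) * ((P ^ (t + 1)) ^ c)⁻¹ := by
      rw [hx, ← Real.rpow_natCast, ← Real.rpow_mul hP0.le, mul_comm, Real.rpow_mul hP0.le,
        Real.rpow_natCast, Real.rpow_sub (by positivity), Real.rpow_one, div_eq_mul_inv]
    rw [h1, show k + (t + 1) - 1 - k + 1 = t + 1 by omega, h2, Real.inv_rpow (by positivity),
      pow_add]
    field_simp
    ring
  rw [Finset.sum_congr rfl e, ← Finset.mul_sum]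
  refine mul_le_mul_of_nonneg_left ?_ (by positivity)
  rw [Finset.sum_range_reflect (fun k => x ^ (k + 1)) N]
  have hs := Summable.sum_le_tsum (Finset.range N) (fun i _ => (pow_pos hx0 i).le)
    (summable_geometric_of_lt_one hx0.le hx1)
  rw [tsum_geometric_of_lt_one hx0.le hx1] at hs
  refine le_trans (Finset.sum_le_sum fun i _ => ?_) hs
  rw [pow_succ]
  exact mul_le_of_le_one_right (pow_pos hx0 i).le hx1.le

lemma rpow_add_mul_self {T B θ : ℝ} (hT : 0 < T) :
    (T ^ (1 / c - 1) / B + 1 / θ) * T = T ^ (1 / c) / B + T / θ := by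
  have h : T ^ (1 / c) = T ^ (1 / c - 1) * T := by
    rw [Real.rpow_sub hT, Real.rpow_one, div_mul_cancel₀ _ hT.ne']
  rw [h]
  ring

/-- `Q` stands for the volume factor of the parent box. The old sets contribute at most `3ⁿ (δ^(1/c)
+ (P^N)^(1-c)) P⁻ᴺ ≤ 3ⁿ · 2δ P⁻ᴺ`. On new turn `k` there are at most `3ⁿ P⁻ᵏ` different answers; the
volume terms add up to `Nα ≤ δ` and the weight terms to a geometric sum, again at most `δ`, both
times `9ⁿ P⁻ᴺ`. -/
lemma total_weight_le (hn : 1 ≤ n) {N : ℕ} {Q : ℝ} (hQ : 0 < Q) (hP : P ∈ Set.Ioo (0 : ℝ) 1)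
    (hα : α ∈ Set.Ioo (0 : ℝ) 1) (hc : c ∈ Set.Ioo (0 : ℝ) 1) (hδ : δ ∈ Set.Ioo (0 : ℝ) 1)
    (h : α ^ c ≤ δ ^ 2 * (1 - P ^ (1 - c))) (hN : δ ≤ 2 * N * α) (hN' : N * α ≤ δ) :
    3 ^ n * ((δ * Q ^ c) ^ (1 / c - 1) / (Q * P ^ N) + 1 / (δ * (Q * P ^ N) ^ c)) * (δ * Q ^ c)
      + ∑ k ∈ Finset.range N, 3 ^ n * (P ^ k)⁻¹ * (3 ^ n *
        (((α * (Q * P ^ k)) ^ c) ^ (1 / c - 1) / (Q * P ^ N) + 1 / (δ * (Q * P ^ N) ^ c)) *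
        (α * (Q * P ^ k)) ^ c)
      ≤ errorTerm n δ * (P ^ N)⁻¹ := by
  have hP0 := hP.1
  have hα0 := hα.1
  have hδ0 := hδ.1
  have hc0 := hc.1
  have hQc : 0 < Q ^ c := Real.rpow_pos_of_pos hQ c
  have hPN : 0 < P ^ N := pow_pos hP0 N
  have hPNc : 0 < (P ^ N) ^ c := Real.rpow_pos_of_pos hPN c
  have hcc : c * (1 / c) = 1 := by field_simp
  have hx1 : P ^ (1 - c) < 1 := Real.rpow_lt_one hP.1.le hP.2 (by linarith [hc.2])
  have hold : 3 ^ n * ((δ * Q ^ c) ^ (1 / c - 1) / (Q * P ^ N) + 1 / (δ * (Q * P ^ N) ^ c)) *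
      (δ * Q ^ c) ≤ 3 ^ n * (2 * δ) * (P ^ N)⁻¹ := by
    rw [mul_assoc, rpow_add_mul_self (by positivity), mul_assoc]
    refine mul_le_mul_of_nonneg_left ?_ (by positivity)
    have e₁ : (δ * Q ^ c) ^ (1 / c) / (Q * P ^ N) = δ ^ (1 / c) * (P ^ N)⁻¹ := by
      rw [Real.mul_rpow hδ0.le hQc.le, ← Real.rpow_mul hQ.le, hcc, Real.rpow_one]
      field_simp
    have e₂ : δ * Q ^ c / (δ * (Q * P ^ N) ^ c) = (P ^ N) ^ (1 - c) * (P ^ N)⁻¹ := by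
      rw [Real.mul_rpow hQ.le hPN.le, Real.rpow_sub hPN, Real.rpow_one]
      field_simp
    rw [e₁, e₂, ← add_mul]
    refine mul_le_mul_of_nonneg_right ?_ (by positivity)
    have h₁ : δ ^ (1 / c) ≤ δ := by
      conv_rhs => rw [← Real.rpow_one δ]
      refine Real.rpow_le_rpow_of_exponent_ge hδ0 hδ.2.le ?_
      rw [one_le_div hc0]
      exact hc.2.le
    linarith [pow_rpow_one_sub_le hP hα hc hδ h hN]
  have hnew : ∑ k ∈ Finset.range N, 3 ^ n * (P ^ k)⁻¹ * (3 ^ n *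
        (((α * (Q * P ^ k)) ^ c) ^ (1 / c - 1) / (Q * P ^ N) + 1 / (δ * (Q * P ^ N) ^ c)) *
        (α * (Q * P ^ k)) ^ c) ≤ 9 ^ n * (2 * δ) * (P ^ N)⁻¹ := by
    have e : ∀ k ∈ Finset.range N, 3 ^ n * (P ^ k)⁻¹ * (3 ^ n *
        (((α * (Q * P ^ k)) ^ c) ^ (1 / c - 1) / (Q * P ^ N) + 1 / (δ * (Q * P ^ N) ^ c)) *
        (α * (Q * P ^ k)) ^ c)
        = 9 ^ n * (α * (P ^ N)⁻¹ + α ^ c / δ * ((P ^ k)⁻¹ * (P ^ k / P ^ N) ^ c)) := by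
      intro k _
      have hPk : 0 < P ^ k := pow_pos hP0 k
      have hPkc : 0 < (P ^ k) ^ c := Real.rpow_pos_of_pos hPk c
      rw [mul_assoc (3 ^ n) (((α * (Q * P ^ k)) ^ c) ^ (1 / c - 1) / (Q * P ^ N) + _),
        rpow_add_mul_self (by positivity), ← Real.rpow_mul (by positivity), hcc, Real.rpow_one,
        Real.mul_rpow hQ.le hPN.le, Real.mul_rpow hα0.le (by positivity),
        Real.mul_rpow hQ.le hPk.le, Real.div_rpow hPk.le hPN.le,
        show (9 : ℝ) ^ n = 3 ^ n * 3 ^ n by rw [← mul_pow]; norm_num]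
      field_simp
    rw [Finset.sum_congr rfl e, ← Finset.mul_sum, mul_assoc (9 ^ n)]
    refine mul_le_mul_of_nonneg_left ?_ (by positivity)
    rw [Finset.sum_add_distrib, ← Finset.mul_sum _ _ (α ^ c / δ), Finset.sum_const,
      Finset.card_range, nsmul_eq_mul, ← mul_assoc, two_mul, add_mul]
    refine add_le_add (mul_le_mul_of_nonneg_right hN' (by positivity)) ?_
    have h1x : 0 < 1 - P ^ (1 - c) := by linarith
    calc α ^ c / δ * _ ≤ (δ ^ 2 * (1 - P ^ (1 - c))) / δ * ((P ^ N)⁻¹ * (1 - P ^ (1 - c))⁻¹) := by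
          gcongr
          exact sum_pow_mul_inv_le hP hc
      _ = δ * (P ^ N)⁻¹ := by field_simp
  refine (add_le_add hold hnew).trans ?_
  rw [← add_mul]
  refine mul_le_mul_of_nonneg_right ?_ (by positivity)
  have e8 : (8 : ℝ) ^ n * (1 + 2 ^ (2 * n + 1)) = 8 ^ n + 2 * 32 ^ n := by
    rw [pow_succ, pow_mul, show (32 : ℝ) = 8 * 2 ^ 2 by norm_num, mul_pow]
    ring
  rw [errorTerm, e8]
  have h₁ : (2 : ℝ) * 3 ^ n ≤ 8 ^ n := by
    obtain ⟨m, rfl⟩ := Nat.exists_eq_add_of_le hn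
    have : (3 : ℝ) ^ m ≤ 8 ^ m := by gcongr; norm_num
    rw [pow_add, pow_add]
    nlinarith [pow_pos (by norm_num : (0 : ℝ) < 3) m]
  have h₂ : (9 : ℝ) ^ n ≤ 32 ^ n := by gcongr; norm_num
  nlinarith

end Numeric

/-- Either one weight alone reaches `θ`, and its truncation is already `1`, or nothing is truncated
and the sum is merely rescaled by `θ⁻¹`. Truncation keeps a large set that meets many children from
counting more than once in each. -/
lemma one_le_sum_min_of_lt_sum {ι X : Type*} {I : Finset ι} {B : ι → Set X} {f : X → ℝ} {θ : ℝ}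
    (hθ : 0 < θ)
    (h : ENNReal.ofReal θ < ∑ m ∈ I, ∑' p, (B m).indicator (fun p => ENNReal.ofReal (f p)) p) :
    1 ≤ ∑ m ∈ I, ∑' p, (B m).indicator (fun p => ENNReal.ofReal (min 1 (f p / θ))) p := by
  by_cases hbig : ∃ m ∈ I, ∃ p ∈ B m, θ ≤ f p
  · obtain ⟨m, hm, p, hp, hle⟩ := hbig
    refine le_trans ?_ (Finset.single_le_sum
      (f := fun m => ∑' p, (B m).indicator (fun p => ENNReal.ofReal (min 1 (f p / θ))) p)
      (fun _ _ => zero_le) hm)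
    refine le_trans ?_ (ENNReal.le_tsum p)
    rw [Set.indicator_of_mem hp, min_eq_left ((one_le_div hθ).2 hle), ENNReal.ofReal_one]
  · push Not at hbig
    have e : ∀ m ∈ I, ∑' p, (B m).indicator (fun p => ENNReal.ofReal (min 1 (f p / θ))) p
        = (∑' p, (B m).indicator (fun p => ENNReal.ofReal (f p)) p) * ENNReal.ofReal θ⁻¹ := by
      intro m hm
      rw [← ENNReal.tsum_mul_right]
      refine tsum_congr fun p => ?_
      by_cases hp : p ∈ B m
      · rw [Set.indicator_of_mem hp, Set.indicator_of_mem hp,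
          min_eq_right ((div_le_one hθ).2 (hbig m hm p hp).le), div_eq_mul_inv,
          ENNReal.ofReal_mul' (by positivity)]
      · rw [Set.indicator_of_notMem hp, Set.indicator_of_notMem hp, zero_mul]
    rw [Finset.sum_congr rfl e, ← Finset.sum_mul]
    calc (1 : ℝ≥0∞) = ENNReal.ofReal θ * ENNReal.ofReal θ⁻¹ := by
          rw [← ENNReal.ofReal_mul hθ.le, mul_inv_cancel₀ hθ.ne', ENNReal.ofReal_one]
      _ ≤ _ := by gcongr

end

/-! ### The potential and the number of bad children -/

section

variable {n : ℕ}

/-- The potential of the box of generation `j` along the address `w`: the weight of all sets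
deleted on earlier turns that meet this box. -/
def potential (β : Fin n → ℝ) (c : ℝ) (N : ℕ) (r : ℝ) (y : Fin n → ℝ)
    (R : ℕ → (ℕ → Fin n → ℤ) → Set (ℝ × (Fin n → ℝ))) (j : ℕ) (w : ℕ → Fin n → ℤ) : ℝ≥0∞ :=
  ∑ m ∈ Finset.range (j * N), ∑' p,
    {p ∈ R m w | Hits β r p (node β N r y w j) (size β r (j * N))}.indicator
      (fun p => ENNReal.ofReal (((∏ i, β i) ^ p.1) ^ c)) p

/-- Each answer depends only on the plays made before it. -/
def Causal (β : Fin n → ℝ) (N : ℕ) (r : ℝ) (y : Fin n → ℝ)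
    (R : ℕ → (ℕ → Fin n → ℤ) → Set (ℝ × (Fin n → ℝ))) : Prop :=
  ∀ m w w', (∀ m' ≤ m, play β N r y w m' = play β N r y w' m') → R m w = R m w'

/-- The weights of the answers are bounded as in the potential game. -/
def WeightBound (β : Fin n → ℝ) (α c : ℝ) (N : ℕ)
    (R : ℕ → (ℕ → Fin n → ℤ) → Set (ℝ × (Fin n → ℝ))) : Prop :=
  ∀ m w, (∀ l, w l ∈ digits β N) →
    ∑' p, (R m w).indicator (fun p => ENNReal.ofReal (((∏ i, β i) ^ p.1) ^ c)) p
      ≤ ENNReal.ofReal ((α * (∏ i, β i) ^ (m + 1)) ^ c)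

variable {β : Fin n → ℝ} {α c δ : ℝ} {N : ℕ} {r : ℝ} {y : Fin n → ℝ}
  {R : ℕ → (ℕ → Fin n → ℤ) → Set (ℝ × (Fin n → ℝ))}

lemma potential_congr (hN : 0 < N) (hR : Causal β N r y R) {j : ℕ} {w w' : ℕ → Fin n → ℤ}
    (h : ∀ l < j, w l = w' l) : potential β c N r y R j w = potential β c N r y R j w' := by
  rw [potential, potential, node_congr h]
  refine Finset.sum_congr rfl fun m hm => ?_
  rw [hR m w w' fun m' hm' =>
    play_congr_of_lt hN h (hm'.trans_lt (Finset.mem_range.1 hm))]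

/-- This bounds the number of histories seen after `k` turns of a generation. The chain values are
at most `(7/20) β^(-k) + 5/8` in absolute value, which leaves at most `(7/10) β^(-k) + 9/4 ≤ 3
β^(-k)` integers per coordinate. -/
lemma card_image_chain_le (hβ : ∀ i, β i ∈ Set.Ioo (0 : ℝ) (1 / 5)) {k : ℕ} (hk : k ≤ N) :
    (((digits β N).image fun z i => chain (β i) (z i) (N - k)).card : ℝ)
      ≤ 3 ^ n * ((∏ i, β i) ^ k)⁻¹ := by
  have hk0 : ∀ i, 0 < (β i ^ k)⁻¹ := fun i => inv_pos.2 (pow_pos (hβ i).1 _)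
  refine (card_int_vec_le _ 0 (fun i => 7 / 20 * (β i ^ k)⁻¹ + 5 / 8)
    (fun i => by have := hk0 i; positivity) ?_).trans ?_
  · intro v hv i
    obtain ⟨z, hz, rfl⟩ := Finset.mem_image.1 hv
    have h₁ := abs_chain_sub_le (hβ i) (z i) (N - k)
    have h₂ := mem_digits_abs_le (fun i => (hβ i).1) hz i
    have hkp : β i ^ k ≠ 0 := (pow_pos (hβ i).1 _).ne'
    have e : 2 * β i ^ (N - k) * z i = 2 * β i ^ N * z i * (β i ^ k)⁻¹ := by
      rw [pow_sub₀ _ (hβ i).1.ne' hk]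
      ring
    have h₃ : |2 * β i ^ (N - k) * z i| ≤ 7 / 20 * (β i ^ k)⁻¹ := by
      rw [e, abs_mul, abs_of_pos (hk0 i)]
      exact mul_le_mul_of_nonneg_right h₂ (hk0 i).le
    simp only [Pi.zero_apply, sub_zero]
    rw [abs_le] at *
    constructor <;> linarith
  · have e : 3 ^ n * ((∏ i, β i) ^ k)⁻¹ = ∏ i, (3 * (β i ^ k)⁻¹) := by
      rw [Finset.prod_mul_distrib, ← Finset.prod_pow, Finset.prod_inv_distrib]
      simp
    rw [e]
    refine Finset.prod_le_prod (fun i _ => by have := hk0 i; positivity) fun i _ => ?_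
    have : 1 ≤ (β i ^ k)⁻¹ := by
      rw [one_le_inv₀ (pow_pos (hβ i).1 _)]
      exact pow_le_one₀ (hβ i).1.le (by linarith [(hβ i).2])
    linarith

lemma node_update_succ (w : ℕ → Fin n → ℤ) (j : ℕ) (z : Fin n → ℤ) :
    node β N r y (Function.update w j z) (j + 1)
      = fun i => node β N r y w j i + 2 * r * β i ^ ((j + 1) * N + 1) * z i := by
  funext i
  rw [node_succ, node_congr (w := Function.update w j z) (w' := w)
    fun l hl => Function.update_of_ne hl.ne _ _, Function.update_self]

lemma update_mem_digits {w : ℕ → Fin n → ℤ} (hw : ∀ l, w l ∈ digits β N) (j : ℕ) {z : Fin n → ℤ}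
    (hz : z ∈ digits β N) (l : ℕ) : Function.update w j z l ∈ digits β N := by
  rcases eq_or_ne l j with rfl | h
  · rwa [Function.update_self]
  · rw [Function.update_of_ne h]
    exact hw l

/-- The weight in the boxes of generation `j + 1` of the sets deleted before generation `j`. -/
lemma sum_old_weight_le (hN : 0 < N) (hr : 0 < r) (hβ : ∀ i, β i ∈ Set.Ioo (0 : ℝ) (1 / 5))
    (hc : c ∈ Set.Ioo (0 : ℝ) 1) {θ T : ℝ} (hθ : 0 < θ) (hT : 0 ≤ T) (hR : Causal β N r y R)
    {j : ℕ} {w : ℕ → Fin n → ℤ} (hw : ∀ l, w l ∈ digits β N)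
    (hpot : potential β c N r y R j w ≤ ENNReal.ofReal T) :
    ∑ z ∈ digits β N, ∑ m ∈ Finset.range (j * N), ∑' p,
      {p ∈ R m (Function.update w j z) | Hits β r p
        (node β N r y (Function.update w j z) (j + 1)) (size β r ((j + 1) * N))}.indicator
        (fun p => ENNReal.ofReal (min 1 (((∏ i, β i) ^ p.1) ^ c / θ))) p
      ≤ ENNReal.ofReal (3 ^ n * (T ^ (1 / c - 1) / (∏ i, β i) ^ ((j + 1) * N + 1) + 1 / θ) * T) := by
  have hβ' : ∀ i, β i ∈ Set.Ioo (0 : ℝ) 1 := fun i => ⟨(hβ i).1, by linarith [(hβ i).2]⟩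
  have hP : 0 < ∏ i, β i := Finset.prod_pos fun i _ => (hβ i).1
  set B : ℕ → Set (ℝ × (Fin n → ℝ)) := fun m =>
    {p ∈ R m w | Hits β r p (node β N r y w j) (size β r (j * N))} with hB
  rw [Finset.sum_comm]
  have key : ∀ m ∈ Finset.range (j * N), ∑ z ∈ digits β N, ∑' p,
      {p ∈ R m (Function.update w j z) | Hits β r p
        (node β N r y (Function.update w j z) (j + 1)) (size β r ((j + 1) * N))}.indicator
        (fun p => ENNReal.ofReal (min 1 (((∏ i, β i) ^ p.1) ^ c / θ))) p
      ≤ ENNReal.ofReal (3 ^ n * (T ^ (1 / c - 1) / (∏ i, β i) ^ ((j + 1) * N + 1) + 1 / θ)) *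
        ∑' p, (B m).indicator (fun p => ENNReal.ofReal (((∏ i, β i) ^ p.1) ^ c)) p := by
    intro m hm
    refine le_trans (Finset.sum_le_sum fun z hz => ENNReal.tsum_le_tsum fun p => ?_)
      (sum_hits_le hβ' hr hc hθ (digits β N) (node β N r y w j) ((j + 1) * N + 1) (B m) ?_)
    -- Earlier answers do not depend on the digit `z`, and a set that meets the child meets the
    -- parent. So only the sets counted in the parent's potential matter.
    · refine Set.indicator_le_indicator_of_subset ?_ (fun _ => zero_le) p
      rintro p ⟨hp, hh⟩
      have hagree : ∀ l < j, Function.update w j z l = w l :=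
        fun l hl => Function.update_of_ne hl.ne _ _
      have hsub := play_anti (y := y) hN hr hβ (update_mem_digits hw j hz)
        (Nat.mul_le_mul_right N j.le_succ)
      rw [play_mul hN hβ (update_mem_digits hw j hz),
        play_mul hN hβ (update_mem_digits hw j hz), node_congr hagree] at hsub
      rw [hR m _ w fun m' hm' =>
        play_congr_of_lt hN hagree (hm'.trans_lt (Finset.mem_range.1 hm))] at hp
      refine ⟨⟨hp, hh.mono hsub⟩, ?_⟩
      rw [node_update_succ] at hh
      exact hh
    -- Each single weight is bounded by the whole potential, hence by `T`.
    · intro p hp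
      rw [← ENNReal.ofReal_le_ofReal_iff hT]
      refine le_trans ?_ hpot
      refine le_trans ?_ (Finset.single_le_sum (f := fun m => ∑' p, (B m).indicator
        (fun p => ENNReal.ofReal (((∏ i, β i) ^ p.1) ^ c)) p) (fun _ _ => zero_le) hm)
      refine le_trans ?_ (ENNReal.le_tsum p)
      rw [Set.indicator_of_mem hp]
  refine (Finset.sum_le_sum key).trans ?_
  rw [← Finset.mul_sum, ENNReal.ofReal_mul (q := T) (by positivity)]
  exact mul_le_mul' le_rfl hpot

/-- The weight in the boxes of generation `j + 1` of the sets deleted on one turn between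
generation `j` and generation `j + 1`. -/
lemma sum_new_weight_le (hr : 0 < r) (hβ : ∀ i, β i ∈ Set.Ioo (0 : ℝ) (1 / 5))
    (hα : 0 < α) (hc : c ∈ Set.Ioo (0 : ℝ) 1) {θ : ℝ} (hθ : 0 < θ) (hR : Causal β N r y R)
    (hRw : WeightBound β α c N R) {j k : ℕ} (hk : k < N) {w : ℕ → Fin n → ℤ}
    (hw : ∀ l, w l ∈ digits β N) {T : ℝ} (hT : T = (α * (∏ i, β i) ^ (j * N + k + 1)) ^ c) :
    ∑ z ∈ digits β N, ∑' p,
      {p ∈ R (j * N + k) (Function.update w j z) | Hits β r p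
        (node β N r y (Function.update w j z) (j + 1)) (size β r ((j + 1) * N))}.indicator
        (fun p => ENNReal.ofReal (min 1 (((∏ i, β i) ^ p.1) ^ c / θ))) p
      ≤ ENNReal.ofReal (3 ^ n * ((∏ i, β i) ^ k)⁻¹ * (3 ^ n *
        (T ^ (1 / c - 1) / (∏ i, β i) ^ ((j + 1) * N + 1) + 1 / θ) * T)) := by
  have hβ' : ∀ i, β i ∈ Set.Ioo (0 : ℝ) 1 := fun i => ⟨(hβ i).1, by linarith [(hβ i).2]⟩
  have hP : 0 < ∏ i, β i := Finset.prod_pos fun i _ => (hβ i).1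
  have hT0 : 0 < T := by rw [hT]; positivity
  set v : (Fin n → ℤ) → Fin n → ℤ := fun z i => chain (β i) (z i) (N - k) with hv
  set X := ENNReal.ofReal (3 ^ n *
        (T ^ (1 / c - 1) / (∏ i, β i) ^ ((j + 1) * N + 1) + 1 / θ) * T) with hX
  -- The digits are grouped by the chain value visible on this turn. Within a group Player II gives
  -- the same answer, so its weight budget is spent once per group.
  rw [← Finset.sum_fiberwise_of_maps_to (g := v) (t := (digits β N).image v)
    fun z hz => Finset.mem_image_of_mem v hz]
  have key : ∀ u ∈ (digits β N).image v, ∑ z ∈ digits β N with v z = u, ∑' p,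
      {p ∈ R (j * N + k) (Function.update w j z) | Hits β r p
        (node β N r y (Function.update w j z) (j + 1)) (size β r ((j + 1) * N))}.indicator
        (fun p => ENNReal.ofReal (min 1 (((∏ i, β i) ^ p.1) ^ c / θ))) p ≤ X := by
    intro u hu
    obtain ⟨z₀, hz₀, rfl⟩ := Finset.mem_image.1 hu
    have hwt := hRw (j * N + k) _ (update_mem_digits hw j hz₀)
    rw [← hT] at hwt
    refine le_trans (Finset.sum_le_sum fun z hz => ENNReal.tsum_le_tsum fun p => ?_)
      ((sum_hits_le (T := T) hβ' hr hc hθ _ (node β N r y w j) ((j + 1) * N + 1)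
        (R (j * N + k) (Function.update w j z₀)) ?_).trans ?_)
    · refine Set.indicator_le_indicator_of_subset ?_ (fun _ => zero_le) p
      rintro p ⟨hp, hh⟩
      rw [hR (j * N + k) _ (Function.update w j z₀) (play_congr hk (fun l hl => by
        rw [Function.update_of_ne hl.ne, Function.update_of_ne hl.ne]) fun i => by
          rw [Function.update_self, Function.update_self]
          exact congrFun (Finset.mem_filter.1 hz).2 i)] at hp
      rw [node_update_succ] at hh
      exact ⟨hp, hh⟩
    · intro p hp
      rw [← ENNReal.ofReal_le_ofReal_iff hT0.le]
      refine le_trans ?_ hwt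
      refine le_trans ?_ (ENNReal.le_tsum p)
      rw [Set.indicator_of_mem hp]
    · rw [hX, ENNReal.ofReal_mul (q := T) (by positivity)]
      exact mul_le_mul' le_rfl hwt
  refine (Finset.sum_le_sum key).trans ?_
  rw [Finset.sum_const, nsmul_eq_mul, ENNReal.ofReal_mul (by positivity), ← ENNReal.ofReal_natCast]
  gcongr
  exact card_image_chain_le hβ hk.le

-- A Markov-type count: each bad child carries truncated weight at least `1`, and the total over all
-- children is bounded by the old and new contributions.
open Classical in
lemma card_bad_digits_le (hn : 1 ≤ n) (hr : 0 < r) (hβ : ∀ i, β i ∈ Set.Ioo (0 : ℝ) (1 / 5))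
    (hα : α ∈ Set.Ioo (0 : ℝ) 1) (hc : c ∈ Set.Ioo (0 : ℝ) 1) (hδ : δ ∈ Set.Ioo (0 : ℝ) 1)
    (h : α ^ c ≤ δ ^ 2 * (1 - (∏ i, β i) ^ (1 - c)))
    (hN : 0 < N) (hN₁ : δ ≤ 2 * N * α) (hN₂ : N * α ≤ δ) (hR : Causal β N r y R)
    (hRw : WeightBound β α c N R) {j : ℕ} {w : ℕ → Fin n → ℤ} (hw : ∀ l, w l ∈ digits β N)
    (hpot : potential β c N r y R j w
      ≤ ENNReal.ofReal (δ * ((∏ i, β i) ^ (j * N + 1)) ^ c)) :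
    (((digits β N).filter fun z => ENNReal.ofReal (δ * ((∏ i, β i) ^ ((j + 1) * N + 1)) ^ c)
      < potential β c N r y R (j + 1) (Function.update w j z)).card : ℝ)
      ≤ errorTerm n δ * ((∏ i, β i) ^ N)⁻¹ := by
  have hP0 : 0 < ∏ i, β i := Finset.prod_pos fun i _ => (hβ i).1
  have hP1 : ∏ i, β i < 1 := by
    have := Finset.prod_lt_prod_of_nonempty (s := Finset.univ) (g := fun _ => (1 : ℝ))
      (fun i _ => (hβ i).1) (fun i _ => by linarith [(hβ i).2]) ⟨⟨0, hn⟩, Finset.mem_univ _⟩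
    simpa using this
  have hδ0 := hδ.1
  have hα0 := hα.1
  set P := ∏ i, β i with hPdef
  set θ := δ * (P ^ ((j + 1) * N + 1)) ^ c with hθdef
  have hθ : 0 < θ := by positivity
  have hL : P ^ ((j + 1) * N + 1) = P ^ (j * N + 1) * P ^ N := by ring
  have herr : 0 ≤ errorTerm n δ * (P ^ N)⁻¹ := by rw [errorTerm]; positivity
  rw [← ENNReal.ofReal_le_ofReal_iff herr, ENNReal.ofReal_natCast]
  refine le_trans ?_ (ENNReal.ofReal_le_ofReal
    (total_weight_le hn (Q := P ^ (j * N + 1)) (by positivity) ⟨hP0, hP1⟩ hα hc hδ h hN₁ hN₂))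
  have hbad : ∀ z ∈ (digits β N).filter fun z => ENNReal.ofReal θ
      < potential β c N r y R (j + 1) (Function.update w j z),
      1 ≤ ∑ m ∈ Finset.range ((j + 1) * N), ∑' p,
      {p ∈ R m (Function.update w j z) | Hits β r p
        (node β N r y (Function.update w j z) (j + 1)) (size β r ((j + 1) * N))}.indicator
        (fun p => ENNReal.ofReal (min 1 ((P ^ p.1) ^ c / θ))) p := fun z hz =>
    one_le_sum_min_of_lt_sum hθ (Finset.mem_filter.1 hz).2
  have hcard := Finset.sum_le_sum hbad
  rw [Finset.sum_const, nsmul_eq_mul, mul_one] at hcard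
  refine hcard.trans ((Finset.sum_le_sum_of_subset (Finset.filter_subset _ _)).trans ?_)
  -- The turns split at generation `j`. The answer to the generation-`j` box itself belongs to the
  -- new turns, as `k = 0`.
  simp only [show (j + 1) * N = j * N + N by ring, Finset.sum_range_add, Finset.sum_add_distrib]
  simp only [← show (j + 1) * N = j * N + N by ring]
  rw [ENNReal.ofReal_add (by positivity) (Finset.sum_nonneg fun k _ => by positivity),
    ENNReal.ofReal_sum_of_nonneg (fun k _ => by positivity), ← hL]
  refine add_le_add (sum_old_weight_le hN hr hβ hc hθ (by positivity) hR hw hpot) ?_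
  rw [Finset.sum_comm]
  refine Finset.sum_le_sum fun k hk => ?_
  refine sum_new_weight_le hr hβ hα0 hc hθ hR hRw (Finset.mem_range.1 hk) hw ?_
  rw [← hPdef]
  ring_nf

/-- Among the boxes of the next generation inside a box of small potential, many have small
potential again. -/
lemma exists_good_digits (hn : 1 ≤ n) (hr : 0 < r) (hβ : ∀ i, β i ∈ Set.Ioo (0 : ℝ) (1 / 5))
    (hα : α ∈ Set.Ioo (0 : ℝ) 1) (hc : c ∈ Set.Ioo (0 : ℝ) 1) (hδ : δ ∈ Set.Ioo (0 : ℝ) 1)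
    (h : α ^ c ≤ δ ^ 2 * (1 - (∏ i, β i) ^ (1 - c)))
    (hN : 0 < N) (hN₁ : δ ≤ 2 * N * α) (hN₂ : N * α ≤ δ) (hR : Causal β N r y R)
    (hRw : WeightBound β α c N R) {j : ℕ} {w : ℕ → Fin n → ℤ} (hw : ∀ l, w l ∈ digits β N)
    (hpot : potential β c N r y R j w
      ≤ ENNReal.ofReal (δ * ((∏ i, β i) ^ (j * N + 1)) ^ c)) :
    ∃ G ⊆ digits β N, ⌈((3 ^ n)⁻¹ * ∏ i, (1 - 5 * β i ^ N) - errorTerm n δ) *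
        ((∏ i, β i) ^ N)⁻¹⌉₊ ≤ G.card ∧
      ∀ z ∈ G, potential β c N r y R (j + 1) (Function.update w j z)
        ≤ ENNReal.ofReal (δ * ((∏ i, β i) ^ ((j + 1) * N + 1)) ^ c) := by
  classical
  refine ⟨(digits β N).filter fun z => ¬ ENNReal.ofReal (δ * ((∏ i, β i) ^ ((j + 1) * N + 1)) ^ c)
      < potential β c N r y R (j + 1) (Function.update w j z), Finset.filter_subset _ _, ?_,
      fun z hz => not_lt.1 (Finset.mem_filter.1 hz).2⟩
  have h₁ := card_bad_digits_le hn hr hβ hα hc hδ h hN hN₁ hN₂ hR hRw hw hpot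
  have h₂ := le_card_digits (N := N) (fun i => (hβ i).1) (fun i => by
    have : β i ^ N ≤ β i := pow_le_of_le_one (hβ i).1.le (by linarith [(hβ i).2]) hN.ne'
    linarith [(hβ i).2])
  rw [← Finset.card_filter_add_card_filter_not (s := digits β N)
    (fun z => ENNReal.ofReal (δ * ((∏ i, β i) ^ ((j + 1) * N + 1)) ^ c)
      < potential β c N r y R (j + 1) (Function.update w j z)), Nat.cast_add] at h₂
  rw [Nat.ceil_le, sub_mul]
  linarith

end

/-! ### Coding by words and the mass distribution principle -/

section

variable {n : ℕ}

open MeasureTheory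

/-- Infinite words over `Fin M` encode branches of a tree in which every good vertex has at least
`M` good successors. -/
lemma exists_coding {Z : Type*} {o : Z} {D : Finset Z} (ho : o ∈ D)
    {Good : ℕ → (ℕ → Z) → Prop}
    (hloc : ∀ j w w', (∀ l < j, w l = w' l) → Good j w → Good j w')
    (h0 : Good 0 fun _ => o) {M : ℕ}
    (step : ∀ j w, (∀ l, w l ∈ D) → Good j w → ∃ G ⊆ D, M ≤ G.card ∧
      ∀ z ∈ G, Good (j + 1) (Function.update w j z)) :
    ∃ Φ : (ℕ → Fin M) → ℕ → Z, (∀ a j, Φ a j ∈ D) ∧ (∀ a j, Good j (Φ a)) ∧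
      ∀ a a' j, (∀ l < j, Φ a l = Φ a' l) → ∀ l < j, a l = a' l := by
  have he : ∀ j w, ∃ e : Fin M → Z, (∀ l, w l ∈ D) → Good j w → Function.Injective e ∧
      ∀ b, e b ∈ D ∧ Good (j + 1) (Function.update w j (e b)) := by
    intro j w
    by_cases h : (∀ l, w l ∈ D) ∧ Good j w
    · obtain ⟨G, hGD, hM, hG⟩ := step j w h.1 h.2
      refine ⟨fun b => G.equivFin.symm (Fin.castLE hM b), fun _ _ => ⟨?_, fun b =>
        ⟨hGD (Subtype.coe_prop _), hG _ (Subtype.coe_prop _)⟩⟩⟩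
      intro b b' hb
      exact Fin.castLE_injective hM (G.equivFin.symm.injective (Subtype.ext hb))
    · exact ⟨fun _ => o, fun h₁ h₂ => (h ⟨h₁, h₂⟩).elim⟩
  choose e he using he
  -- `st a j` has its first `j` letters chosen according to `a` and is constantly `o` from there on,
  -- so the choice at stage `j` depends only on the branch built so far.
  let st : (ℕ → Fin M) → ℕ → ℕ → Z := fun a j =>
    Nat.rec (fun _ => o) (fun j w => Function.update w j (e j w (a j))) j
  have st_succ : ∀ a j, st a (j + 1) = Function.update (st a j) j (e j (st a j) (a j)) :=
    fun _ _ => rfl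
  have hst : ∀ a j, (∀ l, st a j l ∈ D) ∧ Good j (st a j) := by
    intro a j
    induction j with
    | zero => exact ⟨fun _ => ho, h0⟩
    | succ j ih =>
      have h := (he j (st a j) ih.1 ih.2).2 (a j)
      rw [st_succ]
      refine ⟨fun l => ?_, h.2⟩
      rcases eq_or_ne l j with rfl | hl
      · rw [Function.update_self]
        exact h.1
      · rw [Function.update_of_ne hl]
        exact ih.1 l
  have st_ge : ∀ a j l, j ≤ l → st a j l = o := by
    intro a j
    induction j with
    | zero => exact fun _ _ => rfl
    | succ j ih =>
      intro l hl
      rw [st_succ, Function.update_of_ne (by omega)]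
      exact ih l (by omega)
  have st_lt : ∀ a j l, l < j → st a j l = st a (l + 1) l := by
    intro a j l hl
    induction j, (Nat.succ_le_of_lt hl) using Nat.le_induction with
    | base => rfl
    | succ j hj ih =>
      rw [st_succ, Function.update_of_ne (by omega)]
      exact ih (by omega)
  refine ⟨fun a j => st a (j + 1) j, fun a j => (hst a (j + 1)).1 j, fun a j =>
    hloc j _ _ (fun l hl => st_lt a j l hl) (hst a j).2, fun a a' j h => ?_⟩
  induction j with
  | zero => exact fun l hl => by omega
  | succ j ih =>
    have hprev := ih fun l hl => h l (by omega)
    have heq : st a j = st a' j := by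
      funext l
      rcases lt_or_ge l j with hl | hl
      · rw [st_lt a j l hl, st_lt a' j l hl]
        exact h l (by omega)
      · rw [st_ge a j l hl, st_ge a' j l hl]
    intro l hl
    rcases (Nat.lt_succ_iff_lt_or_eq.1 hl) with hl | rfl
    · exact hprev l hl
    · have h₁ := h l (by omega)
      simp only [st_succ, Function.update_self] at h₁
      rw [← heq] at h₁
      exact (he l (st a l) (hst a l).1 (hst a l).2).1 h₁

/-- The uniform product measure on infinite words. -/
def wordMeasure (M : ℕ) [NeZero M] : Measure (ℕ → Fin M) :=
  Measure.infinitePi fun _ => ProbabilityTheory.uniformOn Set.univ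

instance (M : ℕ) [NeZero M] : IsProbabilityMeasure (wordMeasure M) := by
  unfold wordMeasure
  infer_instance

lemma wordMeasure_le_of_prefix {M : ℕ} [NeZero M] (j : ℕ) {E : Set (ℕ → Fin M)}
    (hE : ∀ a ∈ E, ∀ a' ∈ E, ∀ l < j, a l = a' l) :
    wordMeasure M E ≤ ENNReal.ofReal ((M : ℝ) ^ j)⁻¹ := by
  have hM : (0 : ℝ) < M := by exact_mod_cast Nat.pos_of_ne_zero (NeZero.ne M)
  rcases E.eq_empty_or_nonempty with rfl | ⟨a, ha⟩
  · simp
  · have hsub : E ⊆ Set.pi (Finset.range j : Set ℕ) fun l => {a l} := by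
      intro a' ha' l hl
      exact (hE a ha a' ha' l (by simpa using hl)).symm
    refine (measure_mono hsub).trans ?_
    rw [wordMeasure, Measure.infinitePi_pi _ fun _ _ => measurableSet_singleton _]
    have hs : ∀ x : Fin M, ProbabilityTheory.uniformOn Set.univ {x} = ENNReal.ofReal (M : ℝ)⁻¹ := by
      intro x
      rw [ProbabilityTheory.uniformOn_univ, Measure.count_singleton, Fintype.card_fin,
        ENNReal.ofReal_inv_of_pos hM, ENNReal.ofReal_natCast, one_div]
    simp only [hs, Finset.prod_const, Finset.card_range]
    rw [← ENNReal.ofReal_pow (by positivity), inv_pow]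

lemma wordMeasure_le_card {M : ℕ} [NeZero M] (j : ℕ) {E : Set (ℕ → Fin M)} {ι : Type*}
    (code : (ℕ → Fin M) → ι) (hcode : ∀ a a', code a = code a' → ∀ l < j, a l = a' l)
    (B : Finset ι) (hB : ∀ a ∈ E, code a ∈ B) :
    wordMeasure M E ≤ ENNReal.ofReal (B.card * ((M : ℝ) ^ j)⁻¹) := by
  have hsub : E ⊆ ⋃ v ∈ B, {a | code a = v} := by
    intro a ha
    simp only [Set.mem_iUnion]
    exact ⟨code a, hB a ha, rfl⟩
  refine (measure_mono hsub).trans ((measure_biUnion_finset_le _ _).trans ?_)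
  refine (Finset.sum_le_sum fun v _ => wordMeasure_le_of_prefix j
    (E := {a | code a = v}) fun a ha a' ha' => hcode a a' (Eq.trans ha (Eq.symm ha'))).trans ?_
  rw [Finset.sum_const, nsmul_eq_mul, ENNReal.ofReal_mul (Nat.cast_nonneg _),
    ENNReal.ofReal_natCast]

/-- The mass distribution principle for a set that is coded by infinite words. -/
lemma le_dimH_of_coding {X : Type*} [MetricSpace X] {M : ℕ}
    [NeZero M] (F : (ℕ → Fin M) → X) {s : Set X} (hF : ∀ a, F a ∈ s) (d : NNReal) {C T₀ : ℝ}
    (hC : 0 < C) (hT₀ : 0 < T₀)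
    (h : ∀ (t : Set X) (T : ℝ), 0 < T → T ≤ T₀ → (∀ x ∈ t, ∀ x' ∈ t, dist x x' ≤ T) →
      wordMeasure M (F ⁻¹' t) ≤ ENNReal.ofReal (C * T ^ (d : ℝ))) : (d : ℝ≥0∞) ≤ dimH s := by
  borelize X
  have hbound : ∀ t : Set X, Metric.ediam t ≤ ENNReal.ofReal (T₀ / 2) →
      wordMeasure M (F ⁻¹' t) ≤ ENNReal.ofReal C * Metric.ediam t ^ (d : ℝ) := by
    intro t ht
    have hfin : Metric.ediam t ≠ ∞ := ne_top_of_le_ne_top ENNReal.ofReal_ne_top ht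
    set D := (Metric.ediam t).toReal with hD
    have hD0 : 0 ≤ D := ENNReal.toReal_nonneg
    have hDT : D < T₀ := by
      have := ENNReal.toReal_le_of_le_ofReal (by positivity) ht
      linarith
    have hle : ∀ T ∈ Set.Ioo D T₀,
        wordMeasure M (F ⁻¹' t) ≤ ENNReal.ofReal (C * T ^ (d : ℝ)) := by
      intro T hT
      refine h t T (hD0.trans_lt hT.1) hT.2.le fun x hx x' hx' => ?_
      refine le_trans ?_ hT.1.le
      rw [dist_edist, hD]
      exact ENNReal.toReal_mono hfin (Metric.edist_le_ediam_of_mem hx hx')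
    -- The hypothesis covers only `T > 0`, so a set of diameter `D`, possibly `0`, is treated by
    -- letting `T` decrease to `D`.
    have hlim : Filter.Tendsto (fun T : ℝ => ENNReal.ofReal (C * T ^ (d : ℝ)))
        (nhdsWithin D (Set.Ioi D)) (nhds (ENNReal.ofReal (C * D ^ (d : ℝ)))) := by
      refine tendsto_nhdsWithin_of_tendsto_nhds (Continuous.tendsto ?_ D)
      exact ENNReal.continuous_ofReal.comp
        (continuous_const.mul (Real.continuous_rpow_const d.2))
    have hlim' := ge_of_tendsto hlim (Filter.eventually_of_mem (Ioo_mem_nhdsGT hDT) hle)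
    rwa [ENNReal.ofReal_mul hC.le, ← ENNReal.ofReal_rpow_of_nonneg hD0 d.coe_nonneg, hD,
      ENNReal.ofReal_toReal hfin] at hlim'
  refine le_dimH_of_hausdorffMeasure_ne_zero (ne_of_gt ?_)
  refine lt_of_lt_of_le (ENNReal.inv_pos.2 (ENNReal.ofReal_ne_top (r := C))) ?_
  rw [Measure.hausdorffMeasure_apply]
  refine le_trans ?_ (le_iSup₂ (ENNReal.ofReal (T₀ / 2)) (ENNReal.ofReal_pos.2 (by positivity)))
  refine le_iInf fun t => le_iInf fun hst => le_iInf fun ht => ?_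
  rw [ENNReal.inv_le_iff_le_mul (fun _ => (ENNReal.ofReal_pos.2 hC).ne')
    (fun h => (ENNReal.ofReal_ne_top h).elim), ← ENNReal.tsum_mul_left]
  -- Only subadditivity of the outer measure on preimages is needed, so no measurability of `F`
  -- enters.
  have hcov : (Set.univ : Set (ℕ → Fin M)) ⊆ ⋃ i, F ⁻¹' t i := by
    intro a _
    obtain ⟨i, hi⟩ := Set.mem_iUnion.1 (hst (hF a))
    exact Set.mem_iUnion.2 ⟨i, hi⟩
  calc (1 : ℝ≥0∞) = wordMeasure M Set.univ := measure_univ.symm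
    _ ≤ ∑' i, wordMeasure M (F ⁻¹' t i) := (measure_mono hcov).trans (measure_iUnion_le _)
    _ ≤ _ := ENNReal.tsum_le_tsum fun i => by
      rcases (t i).eq_empty_or_nonempty with he | hne
      · simp [he]
      · simpa [hne] using hbound (t i) (ht i)

/-! ### Separation of the boxes and the dimension estimate -/

variable {β : Fin n → ℝ} {N : ℕ} {r : ℝ} {y : Fin n → ℝ}

/-- The cell, in a grid of boxes of generation `j`, of the centre of the box with address `w`. -/
def cell (β : Fin n → ℝ) (N : ℕ) (r : ℝ) (y : Fin n → ℝ) (j : ℕ) (w : ℕ → Fin n → ℤ) :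
    Fin n → ℤ :=
  fun i => ⌊node β N r y w j i / (2 * size β r (j * N) i)⌋

lemma size_pos (hr : 0 < r) (hβ : ∀ i, 0 < β i) (m : ℕ) (i : Fin n) : 0 < size β r m i :=
  mul_pos hr (pow_pos (hβ i) _)

/-- At the first generation where two addresses differ, some coordinate of the nodes differs by at
least two half sides. Each later node drifts by at most the difference of the half sides, so the
generation-`j` nodes stay a full cell width apart in that coordinate. Rounding to cells gives
integer vectors to count, although nodes on different branches need not share a lattice. -/
lemma eq_of_cell_eq (hN : 0 < N) (hr : 0 < r) (hβ : ∀ i, β i ∈ Set.Ioo (0 : ℝ) (1 / 5))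
    {w w' : ℕ → Fin n → ℤ} (hw : ∀ l, w l ∈ digits β N) (hw' : ∀ l, w' l ∈ digits β N) {j : ℕ}
    (h : cell β N r y j w = cell β N r y j w') : ∀ l < j, w l = w' l := by
  intro l
  induction l using Nat.strong_induction_on with
  | _ l ih =>
    intro hl
    funext i
    by_contra hne
    have hs := size_pos hr (fun i => (hβ i).1) (j * N) i
    have h₁ := Int.abs_sub_lt_one_of_floor_eq_floor (congrFun h i)
    rw [← sub_div, abs_div, abs_of_pos (by positivity : 0 < 2 * size β r (j * N) i),
      div_lt_one (by positivity)] at h₁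
    have hle : (l + 1) * N ≤ j * N := Nat.mul_le_mul_right N hl
    have h₂ := abs_center_sub_le (y := y) hN hr hβ hw hle i
    have h₃ := abs_center_sub_le (y := y) hN hr hβ hw' hle i
    rw [center_mul hN hβ hw, center_mul hN hβ hw] at h₂
    rw [center_mul hN hβ hw', center_mul hN hβ hw'] at h₃
    have hs' := size_pos hr (fun i => (hβ i).1) ((l + 1) * N) i
    have e : node β N r y w (l + 1) i - node β N r y w' (l + 1) i
        = 2 * size β r ((l + 1) * N) i * ((w l i : ℝ) - w' l i) := by
      rw [node_succ, node_succ, node_congr fun k hk => ih k hk (hk.trans hl), size]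
      ring
    have h₄ : (1 : ℝ) ≤ |(w l i : ℝ) - w' l i| := by
      exact_mod_cast Int.one_le_abs (sub_ne_zero.2 hne)
    have h₅ : 2 * size β r ((l + 1) * N) i
        ≤ |node β N r y w (l + 1) i - node β N r y w' (l + 1) i| := by
      rw [e, abs_mul, abs_of_pos (by positivity)]
      exact le_mul_of_one_le_right (by positivity) h₄
    have h₆ := abs_sub_le (node β N r y w (l + 1) i) (node β N r y w j i)
      (node β N r y w' (l + 1) i)
    have h₇ := abs_sub_le (node β N r y w j i) (node β N r y w' j i)
      (node β N r y w' (l + 1) i)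
    rw [abs_sub_comm (node β N r y w (l + 1) i) (node β N r y w j i)] at h₆
    linarith

/-- A set of diameter `T` meets few of the boxes of a generation whose boxes are smaller
than `T`. -/
lemma wordMeasure_preimage_le (hN : 0 < N) (hr : 0 < r)
    (hβ : ∀ i, β i ∈ Set.Ioo (0 : ℝ) (1 / 5)) {M : ℕ} [NeZero M]
    {Φ : (ℕ → Fin M) → ℕ → Fin n → ℤ} (hΦ : ∀ a j, Φ a j ∈ digits β N)
    (hinj : ∀ a a' j, (∀ l < j, Φ a l = Φ a' l) → ∀ l < j, a l = a' l)
    {F : (ℕ → Fin M) → Fin n → ℝ} (hF : ∀ a m, F a ∈ play β N r y (Φ a) m)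
    (t : Set (Fin n → ℝ)) {T : ℝ} (ht : ∀ x ∈ t, ∀ x' ∈ t, dist x x' ≤ T) (j : ℕ)
    (hT : ∀ i, size β r (j * N) i ≤ T) :
    wordMeasure M (F ⁻¹' t)
      ≤ ENNReal.ofReal ((6 * T / r) ^ n * ((∏ i, β i) ^ (j * N + 1))⁻¹ * ((M : ℝ) ^ j)⁻¹) := by
  classical
  have hs := size_pos hr (fun i => (hβ i).1) (j * N)
  rcases (F ⁻¹' t).eq_empty_or_nonempty with he | ⟨a₀, ha₀⟩
  · simp [he]
  set h : Fin n → ℝ := fun i => T / (2 * size β r (j * N) i) + 2 with hh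
  set c : Fin n → ℝ := fun i => node β N r y (Φ a₀) j i / (2 * size β r (j * N) i) with hc
  have hh0 : ∀ i, 0 ≤ h i := fun i => by
    have := hs i
    have := this.le.trans (hT i)
    positivity
  set B : Finset (Fin n → ℤ) := Fintype.piFinset fun i => Finset.Icc ⌈c i - h i⌉ ⌊c i + h i⌋
    with hB
  have hmem : ∀ (a : ℕ → Fin M) (i : Fin n),
      |F a i - node β N r y (Φ a) j i| ≤ size β r (j * N) i := by
    intro a i
    have := hF a (j * N)
    rw [play_mul hN hβ (hΦ a)] at this
    exact this i
  have hcode : ∀ a ∈ F ⁻¹' t, cell β N r y j (Φ a) ∈ B := by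
    intro a ha
    rw [hB, Fintype.mem_piFinset]
    intro i
    have h₁ : |F a i - F a₀ i| ≤ T := by
      rw [← Real.dist_eq]
      exact (dist_le_pi_dist _ _ i).trans (ht _ ha _ ha₀)
    have h₂ := hmem a i
    have h₃ := hmem a₀ i
    have h₄ : |node β N r y (Φ a) j i / (2 * size β r (j * N) i) - c i|
        ≤ T / (2 * size β r (j * N) i) + 1 := by
      have hs2 : 0 < 2 * size β r (j * N) i := by have := hs i; positivity
      rw [hc, ← sub_div, abs_div, abs_of_pos hs2, div_add_one hs2.ne']
      refine div_le_div_of_nonneg_right ?_ hs2.le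
      rw [abs_le] at *
      constructor <;> linarith
    have h₅ := Int.floor_le (node β N r y (Φ a) j i / (2 * size β r (j * N) i))
    have h₆ := Int.sub_one_lt_floor (node β N r y (Φ a) j i / (2 * size β r (j * N) i))
    rw [abs_le] at h₄
    rw [Finset.mem_Icc, Int.ceil_le, Int.le_floor, cell]
    simp only [hh]
    constructor <;> linarith
  refine (wordMeasure_le_card j (fun a => cell β N r y j (Φ a)) (fun a a' hcell =>
    hinj a a' j (eq_of_cell_eq hN hr hβ (hΦ a) (hΦ a') hcell)) B hcode).trans ?_
  refine ENNReal.ofReal_le_ofReal (mul_le_mul_of_nonneg_right ?_ (by positivity))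
  refine (card_int_vec_le B c h hh0 fun z hz i => ?_).trans ?_
  · have := Finset.mem_Icc.1 ((Fintype.mem_piFinset.1 hz) i)
    rw [Int.ceil_le, Int.le_floor] at this
    rw [abs_le]
    constructor <;> linarith [this.1, this.2]
  · have e : (6 * T / r) ^ n * ((∏ i, β i) ^ (j * N + 1))⁻¹
        = ∏ i, (6 * (T / size β r (j * N) i)) := by
      have : ∀ i, 6 * (T / size β r (j * N) i) = 6 * T / r * (β i ^ (j * N + 1))⁻¹ := by
        intro i
        rw [size, ← mul_div_assoc, div_mul_eq_div_div, div_eq_mul_inv (6 * T / r)]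
      rw [Finset.prod_congr rfl fun i _ => this i, Finset.prod_mul_distrib, ← Finset.prod_pow,
        Finset.prod_inv_distrib, Finset.prod_const, Finset.card_univ, Fintype.card_fin]
    rw [e]
    -- Here `2h + 1 = T/s + 5 ≤ 6 T/s`, since `s ≤ T`.
    refine Finset.prod_le_prod (fun i _ => by linarith [hh0 i]) fun i _ => ?_
    have h₁ : 1 ≤ T / size β r (j * N) i := (one_le_div (hs i)).2 (hT i)
    have h₂ : T / (2 * size β r (j * N) i) = T / size β r (j * N) i / 2 := by
      rw [mul_comm, div_mul_eq_div_div]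
    simp only [hh, h₂]
    linarith

lemma le_dimH_of_address_coding (hn : 1 ≤ n) (hN : 0 < N) (hr : 0 < r)
    (hβ : ∀ i, β i ∈ Set.Ioo (0 : ℝ) (1 / 5)) {b : ℝ} (hb : ∀ i, β i ≤ b) (hb1 : b < 1)
    {M : ℕ} [NeZero M]
    {Φ : (ℕ → Fin M) → ℕ → Fin n → ℤ} (hΦ : ∀ a j, Φ a j ∈ digits β N)
    (hinj : ∀ a a' j, (∀ l < j, Φ a l = Φ a' l) → ∀ l < j, a l = a' l)
    {F : (ℕ → Fin M) → Fin n → ℝ} (hF : ∀ a m, F a ∈ play β N r y (Φ a) m)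
    {s : Set (Fin n → ℝ)} (hs : ∀ a, F a ∈ s) {κ ε : ℝ} (hκ : 0 < κ)
    (hM : κ * ((∏ i, β i) ^ N)⁻¹ ≤ M) (hε : 0 ≤ ε) (hκε : (b ^ N) ^ ε ≤ κ) (hεn : ε ≤ n) :
    ENNReal.ofReal (n - ε) ≤ dimH s := by
  have hb0 : 0 < b := (hβ ⟨0, hn⟩).1.trans_le (hb _)
  have hP : 0 < ∏ i, β i := Finset.prod_pos fun i _ => (hβ i).1
  set P := ∏ i, β i
  refine le_dimH_of_coding F hs (Real.toNNReal (n - ε))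
    (C := (6 / r) ^ n * P⁻¹ * κ⁻¹ * (r * b) ^ ε) (T₀ := r * b) (by positivity) (by positivity)
    fun t T hT hTr ht => ?_
  have hg0 : 0 < b ^ N := pow_pos hb0 N
  have hg1 : b ^ N < 1 := pow_lt_one₀ hb0.le hb1 hN.ne'
  have hrb : 0 < r * b := by positivity
  -- Generation `k + 1` has all half sides below `T`, while `T / (r * b) ≤ (b^N)^k` converts the
  -- loss `κ⁻ᵏ` into a power `T^(-ε)`.
  obtain ⟨k, hk₁, hk₂⟩ := exists_nat_pow_near_of_lt_one (x := T / (r * b)) (by positivity)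
    ((div_le_one hrb).2 hTr) hg0 hg1
  have hsize : ∀ i, size β r ((k + 1) * N) i ≤ T := by
    intro i
    rw [lt_div_iff₀ hrb] at hk₁
    have h₁ : β i ^ ((k + 1) * N + 1) ≤ b ^ ((k + 1) * N + 1) :=
      pow_le_pow_left₀ (hβ i).1.le (hb i) _
    calc size β r ((k + 1) * N) i ≤ r * b ^ ((k + 1) * N + 1) :=
          mul_le_mul_of_nonneg_left h₁ hr.le
      _ = (b ^ N) ^ (k + 1) * (r * b) := by rw [pow_succ, mul_comm (k + 1), pow_mul]; ring
      _ ≤ T := hk₁.le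
  refine (wordMeasure_preimage_le hN hr hβ hΦ hinj hF t ht (k + 1) hsize).trans
    (ENNReal.ofReal_le_ofReal ?_)
  rw [Real.coe_toNNReal _ (by linarith)]
  have hMpow : ((M : ℝ) ^ (k + 1))⁻¹ ≤ P ^ ((k + 1) * N) * (κ⁻¹ * (κ ^ k)⁻¹) := by
    have h₁ : (κ * (P ^ N)⁻¹) ^ (k + 1) ≤ (M : ℝ) ^ (k + 1) := by gcongr
    refine (inv_anti₀ (by positivity) h₁).trans (le_of_eq ?_)
    rw [mul_pow, inv_pow, ← pow_mul, mul_inv, inv_inv, mul_comm N, pow_succ κ, mul_inv]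
    ring
  have hκk : (κ ^ k)⁻¹ ≤ (r * b) ^ ε * T ^ (-ε) := by
    have h₁ : (T / (r * b)) ^ ε ≤ κ ^ k :=
      calc (T / (r * b)) ^ ε ≤ ((b ^ N) ^ k) ^ ε := by gcongr
        _ = ((b ^ N) ^ ε) ^ k := by
          rw [← Real.rpow_natCast, ← Real.rpow_natCast ((b ^ N) ^ ε), ← Real.rpow_mul hg0.le,
            ← Real.rpow_mul hg0.le, mul_comm]
        _ ≤ κ ^ k := by gcongr
    refine (inv_anti₀ (by positivity) h₁).trans (le_of_eq ?_)
    rw [Real.div_rpow hT.le hrb.le, Real.rpow_neg hT.le, inv_div, div_eq_mul_inv]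
  calc (6 * T / r) ^ n * (P ^ ((k + 1) * N + 1))⁻¹ * ((M : ℝ) ^ (k + 1))⁻¹
      ≤ (6 * T / r) ^ n * (P ^ ((k + 1) * N + 1))⁻¹ *
          (P ^ ((k + 1) * N) * (κ⁻¹ * ((r * b) ^ ε * T ^ (-ε)))) := by
        refine mul_le_mul_of_nonneg_left (hMpow.trans ?_) (by positivity)
        gcongr
    _ = (6 / r) ^ n * P⁻¹ * κ⁻¹ * (r * b) ^ ε * T ^ ((n : ℝ) - ε) := by
        rw [sub_eq_add_neg, Real.rpow_add hT, Real.rpow_natCast, mul_div_right_comm, mul_pow,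
          pow_succ P, mul_inv]
        have := pow_pos hP ((k + 1) * N)
        field_simp

end

/-! ### From a winning strategy to points of the set -/

section

variable {n : ℕ}

/-- A point of a set deleted on turn `m + 1` lies in boxes of large potential. -/
lemma not_mem_of_potential_le {β : Fin n → ℝ} (hβ : ∀ i, β i ∈ Set.Ioo (0 : ℝ) (1 / 5))
    (hn : 1 ≤ n) {c δ : ℝ} (hc : c ∈ Set.Ioo (0 : ℝ) 1) (hδ : δ ∈ Set.Ioo (0 : ℝ) 1) {N : ℕ}
    (hN : 0 < N) {r : ℝ} {y : Fin n → ℝ} {R : ℕ → (ℕ → Fin n → ℤ) → Set (ℝ × (Fin n → ℝ))}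
    {w : ℕ → Fin n → ℤ} (hw : ∀ l, w l ∈ digits β N)
    (hpot : ∀ j, potential β c N r y R j w
      ≤ ENNReal.ofReal (δ * ((∏ i, β i) ^ (j * N + 1)) ^ c))
    {x : Fin n → ℝ} (hx : ∀ m, x ∈ play β N r y w m) (m : ℕ) {p : ℝ × (Fin n → ℝ)}
    (hp : p ∈ R m w) : x ∉ box p.2 fun i => r * β i ^ p.1 := by
  intro hxp
  have hP0 : 0 < ∏ i, β i := Finset.prod_pos fun i _ => (hβ i).1
  have hP1 : ∏ i, β i < 1 := by
    have := Finset.prod_lt_prod_of_nonempty (s := Finset.univ) (g := fun _ => (1 : ℝ))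
      (fun i _ => (hβ i).1) (fun i _ => by linarith [(hβ i).2]) ⟨⟨0, hn⟩, Finset.mem_univ _⟩
    simpa using this
  set P := ∏ i, β i with hP
  have hPq : 0 < P ^ p.1 := Real.rpow_pos_of_pos hP0 _
  -- Generation `m + 1 + k` comes after the deletion on turn `m + 1` and has `P`-power below `P^q`.
  -- The deleted set alone then exceeds the allowed potential, because `δ < 1`.
  obtain ⟨k, hk⟩ := exists_pow_lt_of_lt_one hPq hP1
  have hle : m + 1 + k ≤ (m + 1 + k) * N := Nat.le_mul_of_pos_right _ hN
  have hhit : Hits β r p (node β N r y w (m + 1 + k)) (size β r ((m + 1 + k) * N)) := by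
    have h := hx ((m + 1 + k) * N)
    rw [play_mul hN hβ hw] at h
    exact ⟨x, hxp, h⟩
  have h₁ : ENNReal.ofReal ((P ^ p.1) ^ c) ≤ potential β c N r y R (m + 1 + k) w := by
    refine le_trans ?_ (Finset.single_le_sum (f := fun l => ∑' p,
      {p ∈ R l w | Hits β r p (node β N r y w (m + 1 + k))
        (size β r ((m + 1 + k) * N))}.indicator
      (fun p => ENNReal.ofReal (((∏ i, β i) ^ p.1) ^ c)) p) (fun _ _ => zero_le)
      (Finset.mem_range.2 (by omega : m < (m + 1 + k) * N)))
    refine le_trans ?_ (ENNReal.le_tsum p)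
    have hmem : p ∈ {p ∈ R m w | Hits β r p (node β N r y w (m + 1 + k))
        (size β r ((m + 1 + k) * N))} := ⟨hp, hhit⟩
    rw [Set.indicator_of_mem hmem]
  have h₂ := h₁.trans (hpot (m + 1 + k))
  have hδ0 := hδ.1
  rw [ENNReal.ofReal_le_ofReal_iff (by positivity)] at h₂
  have h₃ : P ^ ((m + 1 + k) * N + 1) ≤ P ^ p.1 :=
    (pow_le_pow_of_le_one hP0.le hP1.le (by omega)).trans hk.le
  have h₄ : (P ^ ((m + 1 + k) * N + 1)) ^ c ≤ (P ^ p.1) ^ c :=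
    Real.rpow_le_rpow (by positivity) h₃ hc.1.le
  have h₅ : 0 < (P ^ p.1) ^ c := Real.rpow_pos_of_pos hPq _
  nlinarith [hδ.2]

/-- After taking logarithms the left side is `-(2Nα/δ) |log κ|`, and `2Nα/δ ≥ 1`. This explains the
factor `2δ⁻¹` in `K₁`. -/
lemma pow_rpow_le_of_abs_log {b κ δ α : ℝ} {N : ℕ} (hb : b ∈ Set.Ioo (0 : ℝ) 1) (hκ : 0 < κ)
    (hδ : 0 < δ) (hN : δ ≤ 2 * N * α) :
    (b ^ N) ^ (2 * δ⁻¹ * |Real.log κ| * (α / |Real.log b|)) ≤ κ := by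
  have hlog : Real.log b < 0 := Real.log_neg hb.1 hb.2
  rw [← Real.log_le_log_iff (Real.rpow_pos_of_pos (pow_pos hb.1 N) _) hκ,
    Real.log_rpow (pow_pos hb.1 N), Real.log_pow, abs_of_neg hlog]
  have e : 2 * δ⁻¹ * |Real.log κ| * (α / -Real.log b) * (N * Real.log b)
      = -(2 * N * α / δ * |Real.log κ|) := by
    have := hlog.ne
    field_simp
  have h₁ : 1 ≤ 2 * N * α / δ := (one_le_div hδ).2 hN
  have h₂ := le_mul_of_one_le_left (abs_nonneg (Real.log κ)) h₁
  rw [e]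
  linarith [neg_abs_le (Real.log κ)]

section Game

variable {A : Matrix (Fin n) (Fin n) ℝ}

lemma affineBox_pow (hA : A.IsDiag) (hβ : ∀ i, 0 < A i i) {r : ℝ} (hr : 0 ≤ r) (m : ℕ)
    (z : Fin n → ℝ) : affineBox (A ^ (m + 1)) r z = box z (size (fun i => A i i) r m) := by
  have h : A ^ (m + 1) = Matrix.diagonal fun i => A i i ^ (m + 1) := by
    conv_lhs => rw [← hA.diagonal_diag, Matrix.diagonal_pow]
    rfl
  rw [h, affineBox_diagonal (fun i => pow_pos (hβ i) _) hr]
  rfl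

lemma isPlay_play (hA : A.IsDiag) (hβ : ∀ j, A j j ∈ Set.Ioo (0 : ℝ) (1 / 5)) {ρ₂ ρ₁ : ℝ}
    (hρ₂ : 0 < ρ₂) (hρ : ρ₂ ≤ ρ₁) {N : ℕ} (hN : 0 < N) (y : Fin n → ℝ) {w : ℕ → Fin n → ℤ}
    (hw : ∀ l, w l ∈ digits (fun i => A i i) N) :
    IsPlay A ρ₂ ρ₁ ρ₂ (play (fun i => A i i) N ρ₂ y w) :=
  ⟨le_rfl, hρ, fun m => ⟨center (fun i => A i i) N ρ₂ y w m, by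
    rw [affineBox_pow hA (fun i => (hβ i).1) hρ₂.le]
    rfl⟩, fun m => play_anti hN hρ₂ hβ hw m.le_succ⟩

lemma weight_le_of_isLegalResponse (hβ : ∀ j, 0 < A j j) {α c : ℝ} (hc : 0 < c) {m : ℕ}
    {C : Set (ℝ × (Fin n → ℝ))} (h : IsLegalResponse A α c m C) :
    ∑' p, C.indicator (fun p => ENNReal.ofReal (((∏ i, A i i) ^ p.1) ^ c)) p
      ≤ ENNReal.ofReal ((α * (∏ i, A i i) ^ m) ^ c) := by
  have h₁ := h.2.2.1 hc
  rw [Finset.prod_pow] at h₁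
  refine le_trans (le_of_eq ?_) h₁
  rw [← tsum_subtype C fun p => ENNReal.ofReal (((∏ i, A i i) ^ p.1) ^ c)]
  refine tsum_congr fun p => ?_
  rw [Real.finsetProd_rpow _ _ (fun i _ => Real.rpow_nonneg (hβ i).le _),
    Real.finsetProd_rpow _ _ (fun i _ => (hβ i).le)]

/-- A winning set contains a set of points that are coded by infinite words whose length-`j`
prefixes are determined by the box of generation `j` that contains the point. -/
lemma exists_coding_of_isWinning (hn : 1 ≤ n) (hA : A.IsDiag)
    (hβ : ∀ j, A j j ∈ Set.Ioo (0 : ℝ) (1 / 5)) {α c ρ₂ ρ₁ δ : ℝ} (hα : α ∈ Set.Ioo (0 : ℝ) 1)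
    (hc : c ∈ Set.Ioo (0 : ℝ) 1) (hρ₂ : 0 < ρ₂) (hρ : ρ₂ ≤ ρ₁) (hδ : δ ∈ Set.Ioo (0 : ℝ) 1)
    (h : α ^ c ≤ δ ^ 2 * (1 - (∏ j, A j j) ^ (1 - c))) {N : ℕ} (hN : 0 < N)
    (hN₁ : δ ≤ 2 * N * α) (hN₂ : N * α ≤ δ) {S : Set (Fin n → ℝ)}
    (hS : IsWinning α A c ρ₂ ρ₁ S) (y : Fin n → ℝ) {M : ℕ}
    (hM : M = ⌈((3 ^ n)⁻¹ * ∏ i, (1 - 5 * A i i ^ N) - errorTerm n δ) *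
        ((∏ i, A i i) ^ N)⁻¹⌉₊) :
    ∃ (Φ : (ℕ → Fin M) → ℕ → Fin n → ℤ) (F : (ℕ → Fin M) → Fin n → ℝ),
      (∀ a j, Φ a j ∈ digits (fun i => A i i) N) ∧
      (∀ a a' j, (∀ l < j, Φ a l = Φ a' l) → ∀ l < j, a l = a' l) ∧
      (∀ a m, F a ∈ play (fun i => A i i) N ρ₂ y (Φ a) m) ∧ ∀ a, F a ∈ S := by
  subst hM
  obtain ⟨σ, hσ⟩ := hS
  have hβ0 : ∀ i, 0 < A i i := fun i => (hβ i).1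
  set β : Fin n → ℝ := fun i => A i i with hβdef
  -- The strategy is viewed as a function of addresses; it is causal because it sees only the plays
  -- made so far.
  set R : ℕ → (ℕ → Fin n → ℤ) → Set (ℝ × (Fin n → ℝ)) :=
    fun m w => σ.response (play β N ρ₂ y w) m with hR
  have hcausal : Causal β N ρ₂ y R := by
    intro m w w' hww
    simp only [hR, Strategy.response]
    congr 1
    funext i
    exact hww i (Nat.lt_succ_iff.1 i.2)
  have hweight : WeightBound β α c N R := fun m w hw =>
    weight_le_of_isLegalResponse hβ0 hc.1
      ((hσ ρ₂ _ (isPlay_play hA hβ hρ₂ hρ hN y hw)).1 m)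
  obtain ⟨Φ, hΦ, hgood, hinj⟩ := exists_coding (zero_mem_digits hβ0 N)
    (Good := fun j w => potential β c N ρ₂ y R j w
      ≤ ENNReal.ofReal (δ * ((∏ i, β i) ^ (j * N + 1)) ^ c))
    (fun j w w' hww hg => by rwa [potential_congr hN hcausal hww] at hg)
    -- Nothing has been deleted before the first play, so the root has potential `0`.
    (by simp [potential])
    (fun j w hw hg => exists_good_digits hn hρ₂ hβ hα hc hδ h hN hN₁ hN₂ hcausal hweight hw hg)
  choose F hF using fun a => exists_mem_iInter_play (y := y) hN hρ₂ hβ (hΦ a)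
  refine ⟨Φ, F, hΦ, hinj, hF, fun a => ?_⟩
  refine (hσ ρ₂ _ (isPlay_play hA hβ hρ₂ hρ hN y (hΦ a))).2 (F a) (Set.mem_iInter.2 (hF a)) ?_
  intro hdel
  obtain ⟨m, hm⟩ := Set.mem_iUnion.1 hdel
  simp only [deleted, Set.mem_iUnion] at hm
  obtain ⟨p, hp, hxp⟩ := hm
  rw [diagPow, affineBox_diagonal (fun i => Real.rpow_pos_of_pos (hβ0 i) _) hρ₂.le] at hxp
  exact not_mem_of_potential_le hβ hn hc hδ hN (hΦ a) (hgood a) (hF a) m hp hxp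

end Game

end

end MatrixPotentialGame

end

/-! ### The theorem -/

open MatrixPotentialGame in
theorem theorem5p2 (n : ℕ) (hn : 1 ≤ n) (A : Matrix (Fin n) (Fin n) ℝ) (hA : A.IsDiag)
    (hβ : ∀ j, A j j ∈ Set.Ioo (0 : ℝ) (1 / 5))
    (α c ρ₂ : ℝ) (hα : α ∈ Set.Ioo (0 : ℝ) 1) (hc : c ∈ Set.Ioo (0 : ℝ) 1) (hρ₂ : 0 < ρ₂)
    (δ : ℝ) (hδ : δ ∈ Set.Ioo (0 : ℝ) 1)
    (h₁ : α ^ c ≤ δ ^ 2 * (1 - (∏ j, A j j) ^ (1 - c)))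
    (h₂ : MatrixPotentialGame.mainTerm A α δ > MatrixPotentialGame.errorTerm n δ)
    (S : Set (Fin n → ℝ)) (hS : S ∈ MatrixPotentialGame.winningFamily α A c ρ₂)
    (y : Fin n → ℝ) :
    (S ∩ MatrixPotentialGame.affineBox A ρ₂ y).Nonempty ∧
    ENNReal.ofReal (max ((n : ℝ) - MatrixPotentialGame.K₁ A α δ *
        (α / |Real.log (MatrixPotentialGame.betaMax A)|)) 0)
      ≤ dimH (S ∩ MatrixPotentialGame.affineBox A ρ₂ y) := by
  obtain ⟨ρ₁, hρ, hS⟩ := hS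
  have hβ0 : ∀ i, 0 < A i i := fun i => (hβ i).1
  have hP0 : 0 < ∏ j, A j j := Finset.prod_pos fun i _ => hβ0 i
  have hαδ : α ^ c ≤ δ ^ 2 := h₁.trans (mul_le_of_le_one_right (sq_nonneg δ)
    (by linarith [Real.rpow_nonneg hP0.le (1 - c)]))
  have hN := one_le_floor_mul_inv hα hc hδ hαδ
  have hN₁ := le_two_mul_floor_mul hα.1 hN
  have hN₂ := floor_mul_inv_mul_le hα.1 hδ.1
  rw [MatrixPotentialGame.K₁]
  have hκ : 0 < mainTerm A α δ - errorTerm n δ := by linarith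
  rw [mainTerm] at *
  set N := ⌊δ * α⁻¹⌋₊
  set κ := (3 ^ n)⁻¹ * ∏ j, (1 - 5 * A j j ^ N) - errorTerm n δ
  obtain ⟨M, hM⟩ : ∃ M, M = ⌈κ * ((∏ i, A i i) ^ N)⁻¹⌉₊ := ⟨_, rfl⟩
  obtain ⟨Φ, F, hΦ, hinj, hF, hFS⟩ :=
    exists_coding_of_isWinning hn hA hβ hα hc hρ₂ hρ hδ h₁ hN hN₁ hN₂ hS y hM
  -- Positivity of `κ` makes the alphabet non-empty; this already gives a point of the intersection.
  have : NeZero M := ⟨hM ▸ (Nat.ceil_pos.2 (by positivity)).ne'⟩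
  have hmem : ∀ a, F a ∈ S ∩ affineBox A ρ₂ y := by
    intro a
    -- The generation-`0` box is the first play `A(B[0,ρ₂]) + y` itself.
    have h := hF a (0 * N)
    have e : node (fun i => A i i) N ρ₂ y (Φ a) 0 = y := by
      funext i
      simp [node]
    rw [play_mul hN hβ (hΦ a), e, Nat.zero_mul, ← affineBox_pow hA hβ0 hρ₂.le, zero_add,
      pow_one] at h
    exact ⟨hFS a, h⟩
  refine ⟨⟨_, hmem fun _ => 0⟩, ?_⟩
  have : Nonempty (Fin n) := ⟨⟨0, hn⟩⟩
  have hle : ∀ i, A i i ≤ betaMax A := fun i =>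
    le_ciSup (f := fun j => A j j) (Set.finite_range _).bddAbove i
  have hb : betaMax A ∈ Set.Ioo (0 : ℝ) 1 := by
    obtain ⟨i, hi⟩ := exists_eq_ciSup_of_finite (f := fun j => A j j)
    rw [betaMax, ← hi]
    exact ⟨hβ0 i, by linarith [(hβ i).2]⟩
  set ε := 2 * δ⁻¹ * |Real.log κ| * (α / |Real.log (betaMax A)|) with hε
  have hα0 := hα.1
  have hδ0 := hδ.1
  have hε0 : 0 ≤ ε := by positivity
  -- If `ε ≥ n`, the claimed lower bound is `0`.
  rcases le_total (n : ℝ) ε with hεn | hεn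
  · rw [max_eq_right (by linarith), ENNReal.ofReal_zero]
    exact zero_le
  · rw [max_eq_left (by linarith)]
    exact le_dimH_of_address_coding hn hN hρ₂ hβ hle hb.2 hΦ hinj hF hmem hκ
      (hM ▸ Nat.le_ceil _) hε0
      (pow_rpow_le_of_abs_log hb hκ hδ0 hN₁) hεn
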